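/- **Conventions.** For tempered distributions on $\mathbb R^3$ the Fourier transform is normalized by $f(x)=\int_{\mathbb R^3}e^{ix\cdot\xi}\widehat f(\xi)\,d\xi$, so that $\widehat{fg}=\widehat f*\widehat g$ and $\widehat{\partial_jf}=i\xi_j\widehat f$. For $i\in\{-1,0,1\}$ let $\chi^i$ be the space of $f\in\mathcal S'(\mathbb R^3)$ (vector-valued, with the Euclidean norm on $\mathbb C^3$) whose Fourier transform is a locally integrable function with $\|f\|_{\chi^i}=\int_{\mathbb R^3}|\xi|^i|\widehat f(\xi)|\,d\xi<\infty$. Let $\mathcal P$ be the Leray projection, $\widehat{(\mathcal Pf)^j}(\xi)=\widehat{f^j}(\xi)-|\xi|^{-2}\sum_{k}\xi_j\xi_k\widehat{f^k}(\xi)$. For $\nu>0$ consider the incompressible Navier–Stokes system $$(NS_\nu)\qquad \partial_tu-\nu\Delta u=\mathcal P\nabla\cdot(u\otimes u),\qquad \operatorname{div}u=0,\qquad u|_{t=0}=u_0,\qquad t>0,\ x\in\mathbb R^3,$$ (the substitution $u\mapsto-u$ gives the opposite sign on the right). A solution in $L^2([0,T];\chi^0)$ is a $u\in L^2([0,T];\chi^0)$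 with $\operatorname{div}u(t)=0$ for a.e. $t$ that satisfies the mild formulation: for a.e. $t\in[0,T]$ and a.e. $\xi$, $$\widehat u(t,\xi)=e^{-\nu t|\xi|^2}\widehat{u_0}(\xi)+\int_0^te^{-\nu(t-s)|\xi|^2}\,\mathcal F\big(\mathcal P\nabla\cdot(u\otimes u)\big)(s,\xi)\,ds .$$ **Theorem.** Let $\nu>0$ and let $u_0\in\chi^{-1}$ be divergence free. There exists $T>0$ such that $(NS_\nu)$ has a unique solution $u$ in $L^2([0,T];\chi^0)$, and (after modification on a null set of times) $u(0)=u_0$ and $$u\in C([0,T];\chi^{-1})\cap L^1([0,T];\chi^1)\cap L^\infty([0,T];\chi^{-1}).$$ Let $T_{u_0}\in(0,\infty]$ be the supremum of all $T>0$ for which a solution in $L^2([0,T];\chi^0)$ exists. There is a $u$ on $[0,T_{u_0})$ with $u(0)=u_0$ that is, for every $0<T<T_{u_0}$, a solution in $L^2([0,T];\chi^0)$ and belongs to the above intersection; for every $T>0$, every solution in $L^2([0,T];\chi^0)$ coincides with $u$ for a.e. $t\in[0,T]$. If $u_0$ is real-valued, so is $u(t)$ for all $t\in[0,T_{u_0})$.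 Moreover: (i) If $\|u_0\|_{\chi^{-1}}<\nu$, then $T_{u_0}=\infty$, and for all $t\ge0$ $$\|u(t)\|_{\chi^{-1}}+\big(\nu-\|u_0\|_{\chi^{-1}}\big)\int_0^t\|u(s)\|_{\chi^1}\,ds\le\|u_0\|_{\chi^{-1}}.$$ (ii) If $T_{u_0}<\infty$, then $\displaystyle\int_0^{T_{u_0}}\|u(t)\|_{\chi^0}^2\,dt=\infty.$ -/

import Mathlib

open MeasureTheory Set Filter Topology
open scoped SchwartzMap FourierTransform LineDeriv ENNReal

noncomputable section

namespace ChiNS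

/-- Physical (and frequency) space `ℝ³` with the Euclidean norm. -/
abbrev R3 : Type := EuclideanSpace ℝ (Fin 3)

/-- `ℂ³` with the Hermitian norm. -/
abbrev C3 : Type := EuclideanSpace ℂ (Fin 3)

/-- Vector-valued tempered distributions on `ℝ³`. -/
abbrev Field3 : Type := 𝓢'(R3, C3)

/-- The Fourier transform of the tempered distribution `f` is the function `g`. Here
`𝓕 φ (ξ) = ∫ exp (-2πi x·ξ) φ(x) dx`, so that `∂ⱼ` becomes multiplication by `2πi ξⱼ` and the
transform of a product is the convolution of the transforms, without constants. -/
def HasFourierDensity (f : Field3) (g : R3 → C3) : Prop :=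
  ∀ φ : 𝓢(R3, ℂ), Integrable (fun ξ => φ ξ • g ξ) ∧ (𝓕 f) φ = ∫ ξ, φ ξ • g ξ

/-- The norm of `χ^s`: `∫ |2πξ|^s |f̂(ξ)| dξ` if the Fourier transform of `f` is a function, and `∞`
otherwise (infimum of the empty set; the density is unique up to a null set). In the frequency
variable `ζ = 2πξ`, with `f(x) = ∫ exp (i x·ζ) f̂(ζ) dζ`, this is `∫ |ζ|^s |f̂(ζ)| dζ`. -/
def chiNorm (s : ℤ) (f : Field3) : ℝ≥0∞ :=
  ⨅ (g : R3 → C3) (_ : HasFourierDensity f g),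
    ∫⁻ ξ, ENNReal.ofReal ((2 * Real.pi * ‖ξ‖) ^ s) * ‖g ξ‖ₑ

/-- Membership in `χ^s`. -/
def MemChi (s : ℤ) (f : Field3) : Prop := chiNorm s f < ⊤

/-- `div f = 0` in the sense of distributions. -/
def IsDivFree (f : Field3) : Prop :=
  ∀ φ : 𝓢(R3, ℂ), ∑ j : Fin 3, (∂_{EuclideanSpace.single j (1 : ℝ)} f) φ j = 0

/-- `f` is real-valued: it takes real values on real test functions. -/
def IsRealField (f : Field3) : Prop :=
  ∀ φ : 𝓢(R3, ℂ), (∀ x, (φ x).im = 0) → ∀ j, (f φ j).im = 0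

/-- `U` is a jointly measurable version, on the time set `I`, of the spatial Fourier transform
`(t, ξ) ↦ û(t, ξ)` of the time-dependent distribution `u`. -/
def HasSpaceTimeDensity (I : Set ℝ) (u : ℝ → Field3) (U : ℝ → R3 → C3) : Prop :=
  AEStronglyMeasurable (Function.uncurry U) ((volume.restrict I).prod volume) ∧
    ∀ᵐ t ∂(volume.restrict I), HasFourierDensity (u t) (U t)

/-- `u ∈ L^p([0,T]; χ^s)`. -/
def MemLpChi (p : ℝ≥0∞) (s : ℤ) (T : ℝ) (u : ℝ → Field3) : Prop :=
  (∃ U, HasSpaceTimeDensity (Icc 0 T) u U) ∧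
    eLpNorm (fun t => chiNorm s (u t)) p (volume.restrict (Icc 0 T)) < ⊤

/-- `u ∈ C([0,T]; χ^s)`. -/
def MemCChi (s : ℤ) (T : ℝ) (u : ℝ → Field3) : Prop :=
  ∀ t ∈ Icc 0 T, MemChi s (u t) ∧
    Tendsto (fun τ => chiNorm s (u τ - u t)) (𝓝[Icc 0 T] t) (𝓝 0)

/-- The symbol of the Leray projection:
`(𝒫 a)ⱼ = aⱼ - |ξ|⁻² ∑ₖ ξⱼ ξₖ aₖ`. -/
def leraySymbol (ξ : R3) (a : C3) : C3 :=
  WithLp.toLp 2 fun j => a j - (∑ k, (ξ j : ℂ) * (ξ k : ℂ) * a k) / ((‖ξ‖ ^ 2 : ℝ) : ℂ)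

/-- For `V = v̂`, the Fourier transform of `div (v ⊗ v)`, whose `l`-th component is
`∑ₖ ∂ₖ (vᵏ vˡ)`; the transform of `vᵏ vˡ` is `∫ v̂ᵏ(η) v̂ˡ(ξ - η) dη`. -/
def divTensorHat (V : R3 → C3) (ξ : R3) : C3 :=
  WithLp.toLp 2 fun l =>
    ∑ k, (2 * Real.pi * Complex.I * (ξ k : ℂ)) * ∫ η, V η k * V (ξ - η) l

/-- For `V = v̂`, the Fourier transform of `𝒫 div (v ⊗ v)`. -/
def nonlinearHat (V : R3 → C3) (ξ : R3) : C3 := leraySymbol ξ (divTensorHat V ξ)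

/-- The symbol of the heat semigroup `exp (tνΔ)`. -/
def heatSymbol (ν t : ℝ) (ξ : R3) : ℝ := Real.exp (-ν * t * (2 * Real.pi * ‖ξ‖) ^ 2)

/-- `u` is a (mild) solution in `L²([0,T]; χ⁰)` of the Navier-Stokes system
`∂ₜu - νΔu = 𝒫 div (u ⊗ u)`, `div u = 0`, `u(0) = u₀`, that is, a fixed point of
`u ↦ exp (tνΔ) u₀ + ∫₀ᵗ exp ((t-s)νΔ) 𝒫 div (u ⊗ u)(s) ds`.
(`-u` solves the system with the opposite sign of the nonlinear term and data `-u₀`.)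
As an element of `L²([0,T]; χ⁰)`, `u` matters for almost every time only. -/
structure IsSolution (ν : ℝ) (u₀ : Field3) (T : ℝ) (u : ℝ → Field3) : Prop where
  memL2 : MemLpChi 2 0 T u
  divFree : ∀ᵐ t ∂(volume.restrict (Icc 0 T)), IsDivFree (u t)
  duhamel : ∃ (U₀ : R3 → C3) (U : ℝ → R3 → C3),
    HasFourierDensity u₀ U₀ ∧ HasSpaceTimeDensity (Icc 0 T) u U ∧
    ∀ᵐ t ∂(volume.restrict (Icc 0 T)), ∀ᵐ ξ,
      U t ξ = heatSymbol ν t ξ • U₀ ξ +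
        ∫ s in (0 : ℝ)..t, heatSymbol ν (t - s) ξ • nonlinearHat (U s) ξ

/-- `u ∈ C([0,T]; χ⁻¹) ∩ L¹([0,T]; χ¹) ∩ L^∞([0,T]; χ⁻¹)`. -/
structure IsRegular (T : ℝ) (u : ℝ → Field3) : Prop where
  cont : MemCChi (-1) T u
  memL1 : MemLpChi 1 1 T u
  memLinfty : MemLpChi ⊤ (-1) T u

/-- The maximal time of existence: the supremum of all `T > 0` such that there is a
solution in `L²([0,T]; χ⁰)`. -/
def maxTime (ν : ℝ) (u₀ : Field3) : ℝ≥0∞ :=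
  ⨆ (T : ℝ) (_ : 0 < T ∧ ∃ u, IsSolution ν u₀ T u), ENNReal.ofReal T

end ChiNS

end

noncomputable section

namespace ChiNS

/-- The weighted norm `∫ |2πξ|^s |g(ξ)| dξ` of a Fourier density. -/
def densityNorm (s : ℤ) (g : R3 → C3) : ℝ≥0∞ :=
  ∫⁻ ξ, ENNReal.ofReal ((2 * Real.pi * ‖ξ‖) ^ s) * ‖g ξ‖ₑ

theorem densityNorm_congr {s : ℤ} {g h : R3 → C3} (H : g =ᵐ[volume] h) :
    densityNorm s g = densityNorm s h :=
  lintegral_congr_ae (H.mono fun ξ hξ => by simp only [hξ])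

theorem locallyIntegrable_of_smul_schwartz {F : Type*} [NormedAddCommGroup F] [NormedSpace ℂ F]
    {g : R3 → F} (h : ∀ φ : 𝓢(R3, ℂ), Integrable (fun ξ => φ ξ • g ξ)) :
    LocallyIntegrable g := by
  intro x
  let b : ContDiffBump x := ⟨1, 2, one_pos, one_lt_two⟩
  have h1 : HasCompactSupport (Complex.ofRealCLM ∘ b) := b.hasCompactSupport.comp_left rfl
  have h2 : ContDiff ℝ ((⊤ : ℕ∞) : WithTop ℕ∞) (Complex.ofRealCLM ∘ b) :=
    Complex.ofRealCLM.contDiff.comp b.contDiff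
  refine ⟨Metric.closedBall x 1, Metric.closedBall_mem_nhds x one_pos, ?_⟩
  refine ((h (h1.toSchwartzMap h2)).integrableOn (s := Metric.closedBall x 1)).congr ?_
  refine (ae_restrict_mem Metric.isClosed_closedBall.measurableSet).mono fun ξ hξ => ?_
  have : b ξ = 1 := b.one_of_mem_closedBall hξ
  simp [this]

theorem ae_eq_zero_of_forall_schwartz {F : Type*} [NormedAddCommGroup F] [NormedSpace ℂ F]
    [CompleteSpace F] {g : R3 → F} (hg : LocallyIntegrable g)
    (h : ∀ φ : 𝓢(R3, ℂ), ∫ ξ, φ ξ • g ξ = 0) : ∀ᵐ ξ, g ξ = 0 := by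
  refine ae_eq_zero_of_integral_contDiff_smul_eq_zero hg fun b hb hc => ?_
  have h1 : HasCompactSupport (Complex.ofRealCLM ∘ b) := hc.comp_left rfl
  have h2 : ContDiff ℝ ((⊤ : ℕ∞) : WithTop ℕ∞) (Complex.ofRealCLM ∘ b) :=
    Complex.ofRealCLM.contDiff.comp hb
  have := h (h1.toSchwartzMap h2)
  simpa using this

namespace HasFourierDensity

variable {f f' : Field3} {g g' : R3 → C3}

theorem locallyIntegrable (h : HasFourierDensity f g) : LocallyIntegrable g :=
  locallyIntegrable_of_smul_schwartz fun φ => (h φ).1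

theorem congr (h : HasFourierDensity f g) (hg : g =ᵐ[volume] g') : HasFourierDensity f g' := by
  intro φ
  have : (fun ξ => φ ξ • g ξ) =ᵐ[volume] fun ξ => φ ξ • g' ξ :=
    hg.mono fun ξ hξ => by simp only [hξ]
  exact ⟨(h φ).1.congr this, (h φ).2.trans (integral_congr_ae this)⟩

theorem sub (h : HasFourierDensity f g) (h' : HasFourierDensity f' g') :
    HasFourierDensity (f - f') (fun ξ => g ξ - g' ξ) := by
  intro φ
  have e : (fun ξ => φ ξ • (g ξ - g' ξ)) = fun ξ => φ ξ • g ξ - φ ξ • g' ξ := by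
    ext1 ξ; rw [smul_sub]
  rw [e]
  refine ⟨(h φ).1.sub (h' φ).1, ?_⟩
  rw [integral_sub (h φ).1 (h' φ).1, ← (h φ).2, ← (h' φ).2]
  rfl

theorem ae_eq (h : HasFourierDensity f g) (h' : HasFourierDensity f g') : g =ᵐ[volume] g' := by
  have h0 := h.sub h'
  have := ae_eq_zero_of_forall_schwartz h0.locallyIntegrable fun φ => by
    rw [← (h0 φ).2, sub_self]; rfl
  exact this.mono fun ξ hξ => sub_eq_zero.1 hξ

theorem unique (h : HasFourierDensity f g) (h' : HasFourierDensity f' g) : f = f' := by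
  have : 𝓕 f = 𝓕 f' := by
    ext1 φ
    rw [(h φ).2, (h' φ).2]
  have e : 𝓕⁻ (𝓕 f) = 𝓕⁻ (𝓕 f') := by rw [this]
  simpa using e

theorem chiNorm_eq (h : HasFourierDensity f g) (s : ℤ) : chiNorm s f = densityNorm s g := by
  refine le_antisymm (iInf₂_le g h) (le_iInf₂ fun g' h' => ?_)
  exact (densityNorm_congr (h.ae_eq h')).le

theorem apply_eq (h : HasFourierDensity f g) (φ : 𝓢(R3, ℂ)) : f φ = ∫ ξ, (𝓕⁻ φ) ξ • g ξ := by
  rw [← (h (𝓕⁻ φ)).2, TemperedDistribution.fourier_apply, FourierTransform.fourier_fourierInv_eq]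

end HasFourierDensity

theorem exists_hasFourierDensity {g : R3 → C3} (hm : AEStronglyMeasurable g)
    (hg : densityNorm (-1) g ≠ ⊤) : ∃ f, HasFourierDensity f g := by
  have hw : (fun ξ : R3 => (((1 + ‖ξ‖ ^ 2 : ℝ)) : ℂ)).HasTemperateGrowth := by fun_prop
  set c : R3 → ℂ := fun ξ => (((1 + ‖ξ‖ ^ 2 : ℝ)) : ℂ) with hc
  have hpos : ∀ ξ : R3, (0 : ℝ) < 1 + ‖ξ‖ ^ 2 := fun ξ => by positivity
  have hh : Integrable (fun ξ => (c ξ)⁻¹ • g ξ) := by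
    refine ⟨?_, ?_⟩
    · refine AEStronglyMeasurable.smul (𝕜 := ℂ) (f := fun ξ => (c ξ)⁻¹) ?_ hm
      have : Measurable c := hw.1.continuous.measurable
      exact this.inv.aestronglyMeasurable
    · have hb : ∀ᵐ ξ : R3, ‖(c ξ)⁻¹ • g ξ‖ₑ ≤
          ENNReal.ofReal (2 * Real.pi) *
            (ENNReal.ofReal ((2 * Real.pi * ‖ξ‖) ^ (-1 : ℤ)) * ‖g ξ‖ₑ) := by
        have h0 : ∀ᵐ ξ : R3, ξ ≠ 0 := by simp [ae_iff]
        filter_upwards [h0] with ξ hξ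
        rw [enorm_smul, ← mul_assoc, ← ENNReal.ofReal_mul (by positivity)]
        refine mul_le_mul_left ?_ _
        rw [← ofReal_norm]
        refine ENNReal.ofReal_le_ofReal ?_
        have hξ' : 0 < ‖ξ‖ := norm_pos_iff.2 hξ
        have : ‖(c ξ)⁻¹‖ = (1 + ‖ξ‖ ^ 2)⁻¹ := by
          rw [norm_inv, hc]
          simp only [Complex.norm_real, Real.norm_eq_abs, abs_of_pos (hpos ξ)]
        rw [this, zpow_neg_one, mul_inv, ← mul_assoc, mul_inv_cancel₀ (by positivity), one_mul]
        exact inv_anti₀ hξ' (by nlinarith [sq_nonneg (‖ξ‖ - 1)])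
      refine (lintegral_mono_ae hb).trans_lt ?_
      rw [lintegral_const_mul' _ _ ENNReal.ofReal_ne_top]
      exact ENNReal.mul_lt_top ENNReal.ofReal_lt_top (lt_top_iff_ne_top.2 hg)
  refine ⟨𝓕⁻ (TemperedDistribution.smulLeftCLM C3 c
    ((memLp_one_iff_integrable.2 hh).toLp _ : Lp C3 1 volume)), fun φ => ?_⟩
  have hae : (fun ξ => (SchwartzMap.smulLeftCLM ℂ c φ) ξ •
      ((memLp_one_iff_integrable.2 hh).toLp _ : Lp C3 1 volume) ξ)
      =ᵐ[volume] fun ξ => φ ξ • g ξ := by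
    filter_upwards [(memLp_one_iff_integrable.2 hh).coeFn_toLp] with ξ hξ
    have hne : c ξ ≠ 0 := by
      exact Complex.ofReal_ne_zero.2 (hpos ξ).ne'
    rw [hξ, SchwartzMap.smulLeftCLM_apply_apply hw, smul_smul, smul_eq_mul,
      mul_right_comm, mul_inv_cancel₀ hne, one_mul]
  constructor
  · have hφ : Integrable (fun ξ => (SchwartzMap.smulLeftCLM ℂ c φ) ξ • ((c ξ)⁻¹ • g ξ)) := by
      refine hh.bdd_smul (φ := (SchwartzMap.smulLeftCLM ℂ c φ : R3 → ℂ))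
        (SchwartzMap.seminorm ℂ 0 0 (SchwartzMap.smulLeftCLM ℂ c φ))
        (SchwartzMap.continuous _).aestronglyMeasurable ?_
      exact .of_forall fun ξ => SchwartzMap.norm_le_seminorm ℂ _ ξ
    refine hφ.congr (EventuallyEq.trans ?_ hae)
    filter_upwards [(memLp_one_iff_integrable.2 hh).coeFn_toLp] with ξ hξ
    rw [hξ]
  · rw [FourierTransform.fourier_fourierInv_eq, TemperedDistribution.smulLeftCLM_apply_apply,
      Lp.toTemperedDistribution_apply]
    exact integral_congr_ae hae

theorem HasFourierDensity.integrable_apply {f : Field3} {g : R3 → C3}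
    (h : HasFourierDensity f g) (φ : 𝓢(R3, ℂ)) (j : Fin 3) :
    Integrable (fun ξ => φ ξ * g ξ j) := by
  simpa using (EuclideanSpace.proj (𝕜 := ℂ) j).integrable_comp (h φ).1

theorem HasFourierDensity.apply_apply {f : Field3} {g : R3 → C3}
    (h : HasFourierDensity f g) (φ : 𝓢(R3, ℂ)) (j : Fin 3) :
    f φ j = ∫ ξ, (𝓕⁻ φ) ξ * g ξ j := by
  rw [h.apply_eq φ]
  have := (EuclideanSpace.proj (𝕜 := ℂ) j).integral_comp_comm (h (𝓕⁻ φ)).1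
  simpa using this.symm

theorem HasFourierDensity.sum_lineDeriv_apply {f : Field3} {g : R3 → C3}
    (h : HasFourierDensity f g) (φ : 𝓢(R3, ℂ)) :
    Integrable (fun ξ => (𝓕⁻ φ) ξ • ∑ j, (ξ j : ℂ) * g ξ j) ∧
    ∑ j : Fin 3, (∂_{EuclideanSpace.single j (1 : ℝ)} f) φ j =
      (2 * Real.pi * Complex.I) * ∫ ξ, (𝓕⁻ φ) ξ • ∑ j, (ξ j : ℂ) * g ξ j := by
  have key : ∀ j : Fin 3, ∀ ξ, (𝓕⁻ (-∂_{EuclideanSpace.single j (1 : ℝ)} φ)) ξ * g ξ j =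
      (2 * Real.pi * Complex.I) * ((𝓕⁻ φ) ξ * ((ξ j : ℂ) * g ξ j)) := by
    intro j ξ
    have hg : (fun x : R3 => inner ℝ x (EuclideanSpace.single j (1 : ℝ))).HasTemperateGrowth := by
      fun_prop
    have e : 𝓕⁻ (-∂_{EuclideanSpace.single j (1 : ℝ)} φ) =
        (2 * Real.pi * Complex.I) • SchwartzMap.smulLeftCLM ℂ
          (fun x : R3 => inner ℝ x (EuclideanSpace.single j (1 : ℝ))) (𝓕⁻ φ) := by
      rw [FourierTransform.fourierInv_neg, SchwartzMap.fourierInv_lineDerivOp_eq, neg_smul, neg_neg]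
    rw [e, smul_apply, SchwartzMap.smulLeftCLM_apply_apply hg]
    have hin : inner ℝ ξ (EuclideanSpace.single j (1 : ℝ)) = ξ j := by
      rw [EuclideanSpace.inner_single_right]; simp
    rw [hin, smul_eq_mul, Complex.real_smul]
    ring
  have hi : ∀ j : Fin 3, Integrable (fun ξ => (𝓕⁻ φ) ξ * ((ξ j : ℂ) * g ξ j)) := by
    intro j
    have := h.integrable_apply (𝓕⁻ (-∂_{EuclideanSpace.single j (1 : ℝ)} φ)) j
    simp_rw [key] at this
    have h2 := this.const_mul (2 * Real.pi * Complex.I)⁻¹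
    refine h2.congr (.of_forall fun ξ => ?_)
    have : (2 * Real.pi * Complex.I) ≠ 0 := Complex.two_pi_I_ne_zero
    simp only
    rw [← mul_assoc, inv_mul_cancel₀ this, one_mul]
  simp_rw [smul_eq_mul, Finset.mul_sum]
  refine ⟨integrable_finsetSum _ fun j _ => hi j, ?_⟩
  rw [integral_finsetSum _ fun j _ => hi j, Finset.mul_sum]
  refine Finset.sum_congr rfl fun j _ => ?_
  rw [TemperedDistribution.lineDerivOp_apply_apply, h.apply_apply]
  simp_rw [key]
  rw [integral_const_mul]

theorem HasFourierDensity.isDivFree_iff {f : Field3} {g : R3 → C3}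
    (h : HasFourierDensity f g) :
    IsDivFree f ↔ ∀ᵐ ξ, ∑ j, (ξ j : ℂ) * g ξ j = 0 := by
  constructor
  · intro hd
    have H : ∀ ψ : 𝓢(R3, ℂ), 𝓕⁻ (𝓕 ψ) = ψ := fun ψ => by simp
    refine ae_eq_zero_of_forall_schwartz (locallyIntegrable_of_smul_schwartz fun ψ => ?_) fun ψ => ?_
    · have := (h.sum_lineDeriv_apply (𝓕 ψ)).1
      rwa [H] at this
    · have := (h.sum_lineDeriv_apply (𝓕 ψ)).2
      rw [hd, H] at this
      exact (mul_eq_zero.1 this.symm).resolve_left Complex.two_pi_I_ne_zero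
  · intro hd φ
    rw [(h.sum_lineDeriv_apply φ).2]
    have : (fun ξ => (𝓕⁻ φ) ξ • ∑ j, (ξ j : ℂ) * g ξ j) =ᵐ[volume] fun _ => 0 :=
      hd.mono fun ξ hξ => by simp only [hξ, smul_zero]
    rw [integral_congr_ae this]
    simp

/-- The Fourier density `ξ ↦ conj (g (-ξ))` of the complex conjugate field. -/
def conjReflect (g : R3 → C3) (ξ : R3) : C3 :=
  WithLp.toLp 2 fun j => (starRingEnd ℂ) (g (-ξ) j)

/-- The complex conjugate of a Schwartz function. -/
def conjSchwartz (φ : 𝓢(R3, ℂ)) : 𝓢(R3, ℂ) :=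
  SchwartzMap.postcompCLM (𝕜 := ℝ) (Complex.conjCLE : ℂ →L[ℝ] ℂ) φ

theorem conjSchwartz_apply (φ : 𝓢(R3, ℂ)) (x : R3) :
    conjSchwartz φ x = (starRingEnd ℂ) (φ x) := by
  simp [conjSchwartz]

theorem conj_fourierInv (φ : 𝓢(R3, ℂ)) (ξ : R3) :
    (starRingEnd ℂ) ((𝓕⁻ φ) ξ) = (𝓕⁻ (conjSchwartz φ)) (-ξ) := by
  rw [SchwartzMap.fourierInv_coe, SchwartzMap.fourierInv_coe, Real.fourierInv_eq',
    Real.fourierInv_eq', ← integral_conj]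
  refine integral_congr_ae (.of_forall fun x => ?_)
  simp [conjSchwartz_apply, ← Complex.exp_conj, Complex.conj_ofNat]

theorem HasFourierDensity.conj_apply {f : Field3} {g : R3 → C3}
    (h : HasFourierDensity f g) (φ : 𝓢(R3, ℂ)) (j : Fin 3) :
    (starRingEnd ℂ) (f φ j) = ∫ ξ, (𝓕⁻ (conjSchwartz φ)) ξ * conjReflect g ξ j := by
  rw [h.apply_apply, ← integral_conj, ← integral_neg_eq_self]
  refine integral_congr_ae (.of_forall fun ξ => ?_)
  simp [conj_fourierInv, conjReflect]

theorem IsRealField.conj_apply {f : Field3} (hf : IsRealField f) (φ : 𝓢(R3, ℂ)) (j : Fin 3) :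
    (starRingEnd ℂ) (f φ j) = f (conjSchwartz φ) j := by
  set a : 𝓢(R3, ℂ) := φ + conjSchwartz φ with ha
  set b : 𝓢(R3, ℂ) := Complex.I • (φ - conjSchwartz φ) with hb
  have h1 : (f a j).im = 0 := hf a (fun x => by simp [ha, conjSchwartz_apply]) j
  have h2 : (f b j).im = 0 := hf b (fun x => by simp [hb, conjSchwartz_apply]) j
  have e1 : f a j = f φ j + f (conjSchwartz φ) j := by rw [ha, map_add]; rfl
  have e2 : f b j = Complex.I * (f φ j - f (conjSchwartz φ) j) := by
    rw [hb, map_smul, map_sub]; rfl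
  rw [e1] at h1
  rw [e2] at h2
  apply Complex.ext
  · simp at h2 ⊢; linarith
  · simp at h1 ⊢; linarith

theorem HasFourierDensity.isRealField_iff {f : Field3} {g : R3 → C3}
    (h : HasFourierDensity f g) : IsRealField f ↔ conjReflect g =ᵐ[volume] g := by
  constructor
  · intro hf
    have H : ∀ ψ : 𝓢(R3, ℂ), 𝓕⁻ (conjSchwartz (conjSchwartz (𝓕 ψ))) = ψ := fun ψ => by
      have : conjSchwartz (conjSchwartz (𝓕 ψ)) = 𝓕 ψ := by
        ext x; simp [conjSchwartz_apply]
      rw [this]; simp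
    have hL : ∀ j : Fin 3, ∀ ψ : 𝓢(R3, ℂ),
        Integrable (fun ξ => ψ ξ * conjReflect g ξ j) := by
      intro j ψ
      have h1 := h.integrable_apply (conjSchwartz (SchwartzMap.compCLMOfContinuousLinearEquiv ℂ
        (ContinuousLinearEquiv.neg ℝ) ψ)) j
      have h2 := ((Complex.conjCLE : ℂ →L[ℝ] ℂ).integrable_comp h1).comp_neg
      refine h2.congr (.of_forall fun ξ => ?_)
      simp [conjSchwartz_apply, conjReflect]
    have hj : ∀ j : Fin 3, ∀ᵐ ξ, conjReflect g ξ j - g ξ j = 0 := by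
      intro j
      have hI : ∀ ψ : 𝓢(R3, ℂ), Integrable (fun ξ => ψ ξ • (conjReflect g ξ j - g ξ j)) := by
        intro ψ
        simp_rw [smul_eq_mul, mul_sub]
        exact (hL j ψ).sub (h.integrable_apply ψ j)
      refine ae_eq_zero_of_forall_schwartz (locallyIntegrable_of_smul_schwartz hI) fun ψ => ?_
      simp_rw [smul_eq_mul, mul_sub]
      rw [integral_sub (hL j ψ) (h.integrable_apply ψ j), sub_eq_zero]
      have e := hf.conj_apply (conjSchwartz (𝓕 ψ)) j
      rwa [h.conj_apply, h.apply_apply, H] at e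
    filter_upwards [ae_all_iff.2 hj] with ξ hξ
    ext j
    exact sub_eq_zero.1 (hξ j)
  · intro hg φ hφ j
    have hc : conjSchwartz φ = φ := by
      ext x
      rw [conjSchwartz_apply, Complex.conj_eq_iff_im, hφ x]
    have e := h.conj_apply φ j
    rw [hc, integral_congr_ae (g := fun ξ => (𝓕⁻ φ) ξ * g ξ j)
      (hg.mono fun ξ hξ => by simp only [hξ]), ← h.apply_apply] at e
    exact Complex.conj_eq_iff_im.1 e

theorem densityNorm_zero (g : R3 → C3) : densityNorm 0 g = ∫⁻ ξ, ‖g ξ‖ₑ := by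
  simp [densityNorm]

/-- The vector `ξ ∈ ℝ³`, regarded as an element of `ℂ³`. -/
def complexify (ξ : R3) : C3 := WithLp.toLp 2 fun j => (ξ j : ℂ)

theorem norm_complexify (ξ : R3) : ‖complexify ξ‖ = ‖ξ‖ := by
  simp [complexify, EuclideanSpace.norm_eq]

theorem inner_complexify (ξ : R3) (a : C3) :
    inner ℂ (complexify ξ) a = ∑ k, (ξ k : ℂ) * a k := by
  simp [complexify, PiLp.inner_apply, mul_comm]

theorem norm_sum_mul_le (ξ : R3) (a : C3) : ‖∑ k, (ξ k : ℂ) * a k‖ ≤ ‖ξ‖ * ‖a‖ := by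
  rw [← inner_complexify, ← norm_complexify]
  exact norm_inner_le_norm _ _

theorem leraySymbol_eq (ξ : R3) (a : C3) :
    leraySymbol ξ a = a - ((∑ k, (ξ k : ℂ) * a k) / ((‖ξ‖ ^ 2 : ℝ) : ℂ)) • complexify ξ := by
  ext j
  simp only [leraySymbol, complexify, PiLp.sub_apply, PiLp.smul_apply, smul_eq_mul]
  rw [div_mul_eq_mul_div, Finset.sum_mul]
  congr 2
  exact Finset.sum_congr rfl fun k _ => by ring

theorem sum_mul_leraySymbol {ξ : R3} (hξ : ξ ≠ 0) (a : C3) :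
    ∑ k, (ξ k : ℂ) * leraySymbol ξ a k = 0 := by
  rw [← inner_complexify, leraySymbol_eq, inner_sub_right, inner_smul_right,
    inner_self_eq_norm_sq_to_K, norm_complexify, inner_complexify]
  have : ((‖ξ‖ : ℝ) : ℂ) ≠ 0 := by exact_mod_cast (norm_pos_iff.2 hξ).ne'
  push_cast
  exact sub_eq_zero.2 (div_mul_cancel₀ _ (pow_ne_zero 2 this)).symm

theorem leraySymbol_zero_left (a : C3) : leraySymbol 0 a = a := by
  rw [leraySymbol_eq]; simp

theorem norm_leraySymbol_le (ξ : R3) (a : C3) : ‖leraySymbol ξ a‖ ≤ ‖a‖ := by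
  by_cases hξ : ξ = 0
  · rw [hξ, leraySymbol_zero_left]
  set c := (∑ k, (ξ k : ℂ) * a k) / ((‖ξ‖ ^ 2 : ℝ) : ℂ) with hc
  have e : a = leraySymbol ξ a + c • complexify ξ := by
    rw [leraySymbol_eq, ← hc, sub_add_cancel]
  have ho : inner ℂ (c • complexify ξ) (leraySymbol ξ a) = 0 := by
    rw [inner_smul_left, inner_complexify, sum_mul_leraySymbol hξ, mul_zero]
  have := norm_add_sq_eq_norm_sq_add_norm_sq_of_inner_eq_zero _ _ ho
  rw [add_comm (c • _), ← e] at this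
  exact abs_le_of_sq_le_sq' (by nlinarith [norm_nonneg (c • complexify ξ)]) (norm_nonneg _) |>.2

theorem leraySymbol_sub (ξ : R3) (a b : C3) :
    leraySymbol ξ (a - b) = leraySymbol ξ a - leraySymbol ξ b := by
  simp only [leraySymbol_eq, PiLp.sub_apply, mul_sub, Finset.sum_sub_distrib, sub_div, sub_smul]
  abel

theorem measurable_convolution {U : ℝ → R3 → C3} (hU : Measurable (Function.uncurry U))
    (k l : Fin 3) :
    Measurable fun p : ℝ × R3 => ∫ η, U p.1 η k * U p.1 (p.2 - η) l := by
  have h : Measurable fun q : (ℝ × R3) × R3 => U q.1.1 q.2 k * U q.1.1 (q.1.2 - q.2) l := by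
    have h1 : Measurable fun q : (ℝ × R3) × R3 => U q.1.1 q.2 :=
      hU.comp (measurable_fst.fst.prodMk measurable_snd)
    have h2 : Measurable fun q : (ℝ × R3) × R3 => U q.1.1 (q.1.2 - q.2) :=
      hU.comp (measurable_fst.fst.prodMk (measurable_fst.snd.sub measurable_snd))
    have hp : ∀ j : Fin 3, Measurable fun a : C3 => a j := fun j =>
      (EuclideanSpace.proj (𝕜 := ℂ) j).continuous.measurable
    exact ((hp k).comp h1).mul ((hp l).comp h2)
  exact (h.stronglyMeasurable.integral_prod_right').measurable

theorem measurable_nonlinearHat {U : ℝ → R3 → C3} (hU : Measurable (Function.uncurry U)) :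
    Measurable fun p : ℝ × R3 => nonlinearHat (U p.1) p.2 := by
  have hcoord : ∀ j : Fin 3, Measurable fun p : ℝ × R3 => ((p.2 j : ℝ) : ℂ) := fun j =>
    Complex.measurable_ofReal.comp
      ((EuclideanSpace.proj (𝕜 := ℝ) j).continuous.measurable.comp measurable_snd)
  have hd : ∀ l : Fin 3, Measurable fun p : ℝ × R3 => divTensorHat (U p.1) p.2 l := by
    intro l
    simp only [divTensorHat]
    exact Finset.measurable_fun_sum _ fun k _ =>
      ((hcoord k).const_mul _).mul (measurable_convolution hU k l)
  have hn : ∀ j : Fin 3, Measurable fun p : ℝ × R3 => nonlinearHat (U p.1) p.2 j := by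
    intro j
    simp only [nonlinearHat, leraySymbol]
    refine (hd j).sub (Measurable.div ?_ ?_)
    · exact Finset.measurable_fun_sum _ fun k _ => ((hcoord j).mul (hcoord k)).mul (hd k)
    · exact Complex.measurable_ofReal.comp (measurable_snd.norm.pow_const 2)
  have : Measurable fun p : ℝ × R3 => fun j => nonlinearHat (U p.1) p.2 j :=
    measurable_pi_lambda _ hn
  exact (PiLp.continuous_toLp 2 _).measurable.comp this

theorem nonlinearHat_congr {V W : R3 → C3} (h : V =ᵐ[volume] W) :
    nonlinearHat V = nonlinearHat W := by
  ext1 ξ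
  have h2 : (fun η => V (ξ - η)) =ᵐ[volume] fun η => W (ξ - η) :=
    (Measure.measurePreserving_sub_left volume ξ).quasiMeasurePreserving.ae_eq h
  have : divTensorHat V ξ = divTensorHat W ξ := by
    simp only [divTensorHat]
    congr 1
    ext1 l
    refine Finset.sum_congr rfl fun k _ => ?_
    congr 1
    refine integral_congr_ae ?_
    filter_upwards [h, h2] with η h1 h2
    rw [h1, h2]
  rw [nonlinearHat, nonlinearHat, this]

theorem divTensorHat_eq {V : R3 → C3} (hV : Measurable V) {ξ : R3}
    (hf : ∫⁻ η, ‖V η‖ₑ * ‖V (ξ - η)‖ₑ ≠ ⊤) :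
    Integrable (fun η => (∑ k, (ξ k : ℂ) * V η k) • V (ξ - η)) ∧
    divTensorHat V ξ =
      (2 * Real.pi * Complex.I) • ∫ η, (∑ k, (ξ k : ℂ) * V η k) • V (ξ - η) := by
  have hp : ∀ j : Fin 3, Measurable fun a : C3 => a j := fun j =>
      (EuclideanSpace.proj (𝕜 := ℂ) j).continuous.measurable
  have hV2 : Measurable fun η => V (ξ - η) := hV.comp (measurable_const.sub measurable_id)
  have hS : Measurable fun η => ∑ k, (ξ k : ℂ) * V η k :=
    Finset.measurable_fun_sum _ fun k _ => ((hp k).comp hV).const_mul _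
  have hi : Integrable (fun η => (∑ k, (ξ k : ℂ) * V η k) • V (ξ - η)) := by
    refine ⟨(hS.smul hV2).aestronglyMeasurable, ?_⟩
    have hb : ∀ η, ‖(∑ k, (ξ k : ℂ) * V η k) • V (ξ - η)‖ₑ ≤
        ENNReal.ofReal ‖ξ‖ * (‖V η‖ₑ * ‖V (ξ - η)‖ₑ) := by
      intro η
      rw [enorm_smul, ← mul_assoc]
      refine mul_le_mul_left ?_ _
      rw [← ofReal_norm, ← ofReal_norm, ← ENNReal.ofReal_mul (norm_nonneg _)]
      exact ENNReal.ofReal_le_ofReal (norm_sum_mul_le _ _)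
    refine (lintegral_mono hb).trans_lt ?_
    rw [lintegral_const_mul' _ _ ENNReal.ofReal_ne_top]
    exact ENNReal.mul_lt_top ENNReal.ofReal_lt_top (lt_top_iff_ne_top.2 hf)
  refine ⟨hi, ?_⟩
  have hkl : ∀ k l : Fin 3, Integrable fun η => V η k * V (ξ - η) l := by
    intro k l
    refine ⟨(((hp k).comp hV).mul ((hp l).comp hV2)).aestronglyMeasurable, ?_⟩
    refine (lintegral_mono fun η => ?_).trans_lt (lt_top_iff_ne_top.2 hf)
    rw [enorm_mul]
    refine mul_le_mul' ?_ ?_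
    · exact enorm_le_iff_norm_le.2 (PiLp.norm_apply_le _ _)
    · exact enorm_le_iff_norm_le.2 (PiLp.norm_apply_le _ _)
  ext l
  have e := (EuclideanSpace.proj (𝕜 := ℂ) l).integral_comp_comm hi
  simp only [EuclideanSpace.coe_proj, PiLp.smul_apply, smul_eq_mul] at e
  rw [PiLp.smul_apply, ← e, smul_eq_mul]
  simp only [divTensorHat, Finset.sum_mul]
  rw [integral_finsetSum _ fun k _ => by
    simpa only [mul_assoc] using (hkl k l).const_mul (ξ k : ℂ), Finset.mul_sum]
  refine Finset.sum_congr rfl fun k _ => ?_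
  simp_rw [mul_assoc]
  rw [integral_const_mul]

theorem enorm_nonlinearHat_sub_le {V W : R3 → C3} (hV : Measurable V) (hW : Measurable W) {ξ : R3}
    (hf : ∫⁻ η, ‖V η‖ₑ * ‖V (ξ - η)‖ₑ ≠ ⊤) (hg : ∫⁻ η, ‖W η‖ₑ * ‖W (ξ - η)‖ₑ ≠ ⊤) :
    ‖nonlinearHat V ξ - nonlinearHat W ξ‖ₑ ≤ ENNReal.ofReal (2 * Real.pi * ‖ξ‖) *
      ∫⁻ η, (‖V η - W η‖ₑ * ‖V (ξ - η)‖ₑ + ‖W η‖ₑ * ‖V (ξ - η) - W (ξ - η)‖ₑ) := by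
  obtain ⟨iV, eV⟩ := divTensorHat_eq hV hf
  obtain ⟨iW, eW⟩ := divTensorHat_eq hW hg
  have h1 : ‖nonlinearHat V ξ - nonlinearHat W ξ‖ₑ ≤ ‖divTensorHat V ξ - divTensorHat W ξ‖ₑ := by
    rw [nonlinearHat, nonlinearHat, ← leraySymbol_sub]
    exact enorm_le_iff_norm_le.2 (norm_leraySymbol_le _ _)
  refine h1.trans ?_
  rw [eV, eW, ← smul_sub, ← integral_sub iV iW, enorm_smul]
  have h2 : ‖(2 * Real.pi * Complex.I : ℂ)‖ₑ = ENNReal.ofReal (2 * Real.pi) := by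
    rw [← ofReal_norm]
    simp [abs_of_pos Real.pi_pos]
  rw [h2, ENNReal.ofReal_mul (p := 2 * Real.pi) (by positivity), mul_assoc]
  refine mul_le_mul' le_rfl ?_
  refine (enorm_integral_le_lintegral_enorm _).trans ?_
  rw [← lintegral_const_mul' _ _ ENNReal.ofReal_ne_top]
  refine lintegral_mono fun η => ?_
  have hb : ∀ a b : C3, ‖(∑ k, (ξ k : ℂ) * a k) • b‖ₑ ≤ ENNReal.ofReal ‖ξ‖ * (‖a‖ₑ * ‖b‖ₑ) := by
    intro a b
    rw [enorm_smul, ← mul_assoc]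
    refine mul_le_mul_left ?_ _
    rw [← ofReal_norm, ← ofReal_norm, ← ENNReal.ofReal_mul (norm_nonneg _)]
    exact ENNReal.ofReal_le_ofReal (norm_sum_mul_le _ _)
  have e : (∑ k, (ξ k : ℂ) * V η k) • V (ξ - η) - (∑ k, (ξ k : ℂ) * W η k) • W (ξ - η) =
      (∑ k, (ξ k : ℂ) * (V η - W η) k) • V (ξ - η) +
      (∑ k, (ξ k : ℂ) * W η k) • (V (ξ - η) - W (ξ - η)) := by
    simp only [PiLp.sub_apply, mul_sub, Finset.sum_sub_distrib, sub_smul, smul_sub]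
    abel
  rw [e, mul_add]
  exact (enorm_add_le _ _).trans (add_le_add (hb _ _) (hb _ _))

theorem lintegral_convolution {f g : R3 → ℝ≥0∞} (hf : Measurable f) (hg : Measurable g) :
    ∫⁻ ξ, ∫⁻ η, f η * g (ξ - η) = (∫⁻ η, f η) * ∫⁻ η, g η := by
  have hm : Measurable (Function.uncurry fun ξ η : R3 => f η * g (ξ - η)) :=
    (hf.comp measurable_snd).mul (hg.comp (measurable_fst.sub measurable_snd))
  rw [lintegral_lintegral_swap hm.aemeasurable]
  have : ∀ η, ∫⁻ ξ, f η * g (ξ - η) = f η * ∫⁻ ξ, g ξ := by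
    intro η
    rw [lintegral_const_mul _ (f := fun ξ => g (ξ - η)) (hg.comp (measurable_id.sub_const η))]
    congr 1
    exact lintegral_sub_right_eq_self g η
  simp_rw [this]
  rw [lintegral_mul_const _ hf]

theorem ofReal_zpow_neg_one_mul_le (x : ℝ) :
    ENNReal.ofReal (x ^ (-1 : ℤ)) * ENNReal.ofReal x ≤ 1 := by
  by_cases hx : x ≤ 0
  · rw [ENNReal.ofReal_of_nonpos hx, mul_zero]; exact zero_le_one
  · push Not at hx
    rw [← ENNReal.ofReal_mul (by positivity), zpow_neg_one, inv_mul_cancel₀ hx.ne',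
      ENNReal.ofReal_one]

theorem ae_convolution_ne_top {V : R3 → C3} (hV : Measurable V) (h : densityNorm 0 V ≠ ⊤) :
    ∀ᵐ ξ, ∫⁻ η, ‖V η‖ₑ * ‖V (ξ - η)‖ₑ ≠ ⊤ := by
  have hm : Measurable (Function.uncurry fun ξ η : R3 => ‖V η‖ₑ * ‖V (ξ - η)‖ₑ) :=
    ((hV.comp measurable_snd).enorm).mul (hV.comp (measurable_fst.sub measurable_snd)).enorm
  refine (ae_lt_top hm.lintegral_prod_right ?_).mono fun ξ h => h.ne
  have := lintegral_convolution hV.enorm hV.enorm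
  rw [densityNorm_zero] at h
  rw [this]
  exact ENNReal.mul_ne_top h h

theorem densityNorm_nonlinearHat_sub_le {V W : R3 → C3} (hV : Measurable V) (hW : Measurable W)
    (hf : densityNorm 0 V ≠ ⊤) (hg : densityNorm 0 W ≠ ⊤) :
    densityNorm (-1) (fun ξ => nonlinearHat V ξ - nonlinearHat W ξ) ≤
      (densityNorm 0 V + densityNorm 0 W) * densityNorm 0 (fun ξ => V ξ - W ξ) := by
  have hm1 : Measurable (Function.uncurry fun ξ η : R3 => ‖V η - W η‖ₑ * ‖V (ξ - η)‖ₑ) :=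
    (((hV.sub hW).comp measurable_snd).enorm).mul
      (hV.comp (measurable_fst.sub measurable_snd)).enorm
  have key : densityNorm (-1) (fun ξ => nonlinearHat V ξ - nonlinearHat W ξ) ≤
      ∫⁻ ξ, ∫⁻ η, (‖V η - W η‖ₑ * ‖V (ξ - η)‖ₑ + ‖W η‖ₑ * ‖V (ξ - η) - W (ξ - η)‖ₑ) := by
    refine lintegral_mono_ae ?_
    filter_upwards [ae_convolution_ne_top hV hf, ae_convolution_ne_top hW hg] with ξ h1 h2
    refine (mul_le_mul_right (enorm_nonlinearHat_sub_le hV hW h1 h2) _).trans ?_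
    rw [← mul_assoc]
    exact (mul_le_mul_left (ofReal_zpow_neg_one_mul_le _) _).trans (one_mul _).le
  refine key.trans ?_
  have e : ∀ ξ, ∫⁻ η, (‖V η - W η‖ₑ * ‖V (ξ - η)‖ₑ + ‖W η‖ₑ * ‖V (ξ - η) - W (ξ - η)‖ₑ) =
      (∫⁻ η, ‖V η - W η‖ₑ * ‖V (ξ - η)‖ₑ) + ∫⁻ η, ‖W η‖ₑ * ‖V (ξ - η) - W (ξ - η)‖ₑ := by
    intro ξ
    exact lintegral_add_left (hm1.comp (measurable_const.prodMk measurable_id)) _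
  simp_rw [e]
  rw [lintegral_add_left hm1.lintegral_prod_right]
  have e1 := lintegral_convolution (f := fun η => ‖V η - W η‖ₑ) (hV.sub hW).enorm hV.enorm
  have e2 := lintegral_convolution (g := fun η => ‖V η - W η‖ₑ) hW.enorm (hV.sub hW).enorm
  simp only [densityNorm_zero]
  rw [e1, e2, mul_comm, add_mul]

theorem nonlinearHat_zero : nonlinearHat (fun _ => 0) = fun _ => 0 := by
  ext ξ j
  simp [nonlinearHat, leraySymbol, divTensorHat]

theorem densityNorm_nonlinearHat_le {V : R3 → C3} (hV : Measurable V) :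
    densityNorm (-1) (nonlinearHat V) ≤ densityNorm 0 V ^ 2 := by
  by_cases hf : densityNorm 0 V = ⊤
  · simp [hf]
  have := densityNorm_nonlinearHat_sub_le hV (W := fun _ => 0) measurable_const hf
    (by simp [densityNorm])
  simp only [nonlinearHat_zero, sub_zero] at this
  refine this.trans_eq ?_
  simp [densityNorm_zero, sq]

theorem sum_mul_nonlinearHat (V : R3 → C3) {ξ : R3} (hξ : ξ ≠ 0) :
    ∑ j, (ξ j : ℂ) * nonlinearHat V ξ j = 0 :=
  sum_mul_leraySymbol hξ _

theorem nonlinearHat_conjReflect (V : R3 → C3) :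
    nonlinearHat (conjReflect V) = conjReflect (nonlinearHat V) := by
  have hd : ∀ ξ l, divTensorHat (conjReflect V) ξ l =
      (starRingEnd ℂ) (divTensorHat V (-ξ) l) := by
    intro ξ l
    simp only [divTensorHat, conjReflect, map_sum, map_mul, ← integral_conj]
    refine Finset.sum_congr rfl fun k _ => ?_
    congr 1
    · simp [Complex.conj_ofNat]
    · rw [← integral_neg_eq_self]
      refine integral_congr_ae (.of_forall fun η => ?_)
      simp only [neg_neg]
      rw [show -(ξ - -η) = -ξ - η by abel]
  ext ξ j
  simp only [nonlinearHat, leraySymbol, conjReflect, map_sub, map_div₀, map_sum, map_mul, hd]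
  simp

theorem sq_lintegral_le {α : Type*} [MeasurableSpace α] {μ : Measure α} {f g h : α → ℝ≥0∞}
    (hf : AEMeasurable f μ) (hg : AEMeasurable g μ) (hh : ∀ᵐ x ∂μ, h x ^ 2 ≤ f x * g x) :
    (∫⁻ x, h x ∂μ) ^ 2 ≤ (∫⁻ x, f x ∂μ) * ∫⁻ x, g x ∂μ := by
  have hsq : ∀ a : ℝ≥0∞, (a ^ (1 / 2 : ℝ)) ^ 2 = a := fun a => by
    rw [← ENNReal.rpow_natCast, ← ENNReal.rpow_mul]; norm_num
  have h1 : ∫⁻ x, h x ∂μ ≤ ∫⁻ x, f x ^ (1 / 2 : ℝ) * g x ^ (1 / 2 : ℝ) ∂μ := by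
    refine lintegral_mono_ae (hh.mono fun x hx => ?_)
    rw [← ENNReal.mul_rpow_of_nonneg _ _ (by norm_num)]
    refine le_trans (le_of_eq ?_) (ENNReal.rpow_le_rpow hx (by norm_num : (0 : ℝ) ≤ 1 / 2))
    rw [← ENNReal.rpow_natCast, ← ENNReal.rpow_mul]; norm_num
  have h2 := ENNReal.lintegral_mul_norm_pow_le hf hg (by norm_num : (0 : ℝ) ≤ 1 / 2)
    (by norm_num : (0 : ℝ) ≤ 1 / 2) (by norm_num)
  calc (∫⁻ x, h x ∂μ) ^ 2 ≤ ((∫⁻ x, f x ∂μ) ^ (1 / 2 : ℝ) * (∫⁻ x, g x ∂μ) ^ (1 / 2 : ℝ)) ^ 2 :=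
        pow_le_pow_left' (h1.trans h2) 2
    _ = _ := by rw [mul_pow, hsq, hsq]

theorem measurable_weight (s : ℤ) :
    Measurable fun ξ : R3 => ENNReal.ofReal ((2 * Real.pi * ‖ξ‖) ^ s) :=
  ENNReal.measurable_ofReal.comp ((measurable_norm.const_mul _).pow_const s)

theorem measurable_weight_mul (s : ℤ) {f : R3 → ℝ≥0∞} (hf : Measurable f) :
    Measurable fun ξ : R3 => ENNReal.ofReal ((2 * Real.pi * ‖ξ‖) ^ s) * f ξ :=
  (measurable_weight s).mul hf

theorem sq_densityNorm_zero_le {g : R3 → C3} (hg : Measurable g) :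
    densityNorm 0 g ^ 2 ≤ densityNorm (-1) g * densityNorm 1 g := by
  rw [densityNorm_zero]
  refine sq_lintegral_le (measurable_weight_mul _ hg.enorm).aemeasurable
    (measurable_weight_mul _ hg.enorm).aemeasurable ?_
  have h0 : ∀ᵐ ξ : R3, ξ ≠ 0 := by simp [ae_iff]
  filter_upwards [h0] with ξ hξ
  have hpos : 0 < 2 * Real.pi * ‖ξ‖ := by
    have := norm_pos_iff.2 hξ
    positivity
  have e : ENNReal.ofReal ((2 * Real.pi * ‖ξ‖) ^ (-1 : ℤ)) *
      ENNReal.ofReal ((2 * Real.pi * ‖ξ‖) ^ (1 : ℤ)) = 1 := by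
    rw [← ENNReal.ofReal_mul (by positivity), zpow_neg_one, zpow_one, inv_mul_cancel₀ hpos.ne',
      ENNReal.ofReal_one]
  rw [mul_mul_mul_comm, e, one_mul, sq]

theorem ofReal_exp_add_lintegral {a : ℝ} (ha : 0 ≤ a) {s t : ℝ} (hst : s ≤ t) :
    ENNReal.ofReal (Real.exp (-a * (t - s))) +
      ENNReal.ofReal a * ∫⁻ τ in Ioc s t, ENNReal.ofReal (Real.exp (-a * (τ - s))) = 1 := by
  have hd : ∀ τ ∈ uIcc s t, HasDerivAt (fun τ => -Real.exp (-a * (τ - s)))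
      (a * Real.exp (-a * (τ - s))) τ := by
    intro τ _
    have h1 : HasDerivAt (fun τ => -a * (τ - s)) (-a) τ := by
      simpa using ((hasDerivAt_id τ).sub_const s).const_mul (-a)
    have := h1.exp.neg
    rwa [show -(Real.exp (-a * (τ - s)) * -a) = a * Real.exp (-a * (τ - s)) by ring] at this
  have hc : Continuous fun τ => a * Real.exp (-a * (τ - s)) := by fun_prop
  have hi := intervalIntegral.integral_eq_sub_of_hasDerivAt hd (hc.intervalIntegrable _ _)
  rw [intervalIntegral.integral_of_le hst] at hi
  have hii : Integrable (fun τ => a * Real.exp (-a * (τ - s))) (volume.restrict (Ioc s t)) :=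
    (hc.integrableOn_Icc (a := s) (b := t)).mono_set Ioc_subset_Icc_self
  rw [← lintegral_const_mul' _ _ ENNReal.ofReal_ne_top]
  simp_rw [← ENNReal.ofReal_mul ha]
  rw [← ofReal_integral_eq_lintegral_ofReal hii (.of_forall fun τ => by positivity), hi,
    ← ENNReal.ofReal_add (by positivity)]
  · simp
  · simp only [sub_self, mul_zero, Real.exp_zero]
    have : Real.exp (-a * (t - s)) ≤ 1 := Real.exp_le_one_iff.2 (by nlinarith)
    linarith

/-- The scalar Duhamel formula, with its dissipation identity. -/
theorem scalar_duhamel_identity {a : ℝ} (ha : 0 ≤ a) (f : ℝ≥0∞) {G : ℝ → ℝ≥0∞} (hG : Measurable G)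
    {t : ℝ} (ht : 0 ≤ t) :
    (ENNReal.ofReal (Real.exp (-a * t)) * f +
        ∫⁻ s in Ioc 0 t, ENNReal.ofReal (Real.exp (-a * (t - s))) * G s) +
      ENNReal.ofReal a * ∫⁻ τ in Ioc 0 t, (ENNReal.ofReal (Real.exp (-a * τ)) * f +
        ∫⁻ s in Ioc 0 τ, ENNReal.ofReal (Real.exp (-a * (τ - s))) * G s) =
    f + ∫⁻ s in Ioc 0 t, G s := by
  set e : ℝ → ℝ≥0∞ := fun x => ENNReal.ofReal (Real.exp (-a * x)) with he
  have hem : Measurable e := by fun_prop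
  change (e t * f + ∫⁻ s in Ioc 0 t, e (t - s) * G s) +
    ENNReal.ofReal a * ∫⁻ τ in Ioc 0 t, (e τ * f + ∫⁻ s in Ioc 0 τ, e (τ - s) * G s) = _
  have hE : ∀ s ≤ t, e (t - s) + ENNReal.ofReal a * ∫⁻ τ in Ioc s t, e (τ - s) = 1 :=
    fun s hs => ofReal_exp_add_lintegral ha hs
  have hswap : ∫⁻ τ in Ioc 0 t, ∫⁻ s in Ioc 0 τ, e (τ - s) * G s =
      ∫⁻ s in Ioc 0 t, (∫⁻ τ in Ioc s t, e (τ - s)) * G s := by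
    have hS : MeasurableSet {p : ℝ × ℝ | p.2 ≤ p.1} := measurableSet_le measurable_snd measurable_fst
    have hm : Measurable (Function.uncurry fun τ s : ℝ => e (τ - s) * G s) :=
      (hem.comp (measurable_fst.sub measurable_snd)).mul (hG.comp measurable_snd)
    have h1 : ∀ τ ∈ Ioc 0 t, ∫⁻ s in Ioc 0 τ, e (τ - s) * G s =
        ∫⁻ s in Ioc 0 t, {p : ℝ × ℝ | p.2 ≤ p.1}.indicator
          (Function.uncurry fun τ s : ℝ => e (τ - s) * G s) (τ, s) := by
      intro τ hτ
      have : Ioc 0 τ = Ioc 0 t ∩ Iic τ := by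
        ext s; simp only [mem_Ioc, mem_inter_iff, mem_Iic]
        exact ⟨fun h => ⟨⟨h.1, h.2.trans hτ.2⟩, h.2⟩, fun h => ⟨h.1.1, h.2⟩⟩
      rw [this, inter_comm, ← Measure.restrict_restrict measurableSet_Iic,
        ← lintegral_indicator measurableSet_Iic]
      rfl
    rw [setLIntegral_congr_fun measurableSet_Ioc h1,
      lintegral_lintegral_swap (f := fun τ s => {p : ℝ × ℝ | p.2 ≤ p.1}.indicator
        (Function.uncurry fun τ s : ℝ => e (τ - s) * G s) (τ, s)) (hm.indicator hS).aemeasurable]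
    refine setLIntegral_congr_fun measurableSet_Ioc fun s hs => ?_
    have hcut : ∫⁻ τ in Ioc s t, e (τ - s) = ∫⁻ τ in Ioc 0 t, (Ici s).indicator
        (fun τ => e (τ - s)) τ := by
      rw [lintegral_indicator measurableSet_Ici, Measure.restrict_restrict measurableSet_Ici]
      refine setLIntegral_congr ?_
      have : Ici s ∩ Ioc 0 t = Icc s t := by
        ext τ; simp only [mem_Ioc, mem_inter_iff, mem_Ici, mem_Icc]
        exact ⟨fun h => ⟨h.1, h.2.2⟩, fun h => ⟨h.1, hs.1.trans_le h.1, h.2⟩⟩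
      rw [this]
      exact Ioc_ae_eq_Icc
    simp only [hcut]
    have hes : Measurable fun τ => e (τ - s) := hem.comp (measurable_id.sub_const s)
    rw [← lintegral_mul_const _ (hes.indicator measurableSet_Ici)]
    refine lintegral_congr fun τ => ?_
    by_cases h : s ≤ τ
    · simp [indicator, h]
    · simp [indicator, h]
  have h2 : ∀ s ∈ Ioc 0 t, e (t - s) * G s +
      ENNReal.ofReal a * ((∫⁻ τ in Ioc s t, e (τ - s)) * G s) = G s := by
    intro s hs
    rw [← mul_assoc, ← add_mul, hE s hs.2, one_mul]
  rw [lintegral_add_left (hem.mul_const f), lintegral_mul_const _ hem, hswap, mul_add,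
    add_add_add_comm, ← mul_assoc, ← add_mul]
  have h0 := hE 0 ht
  simp only [sub_zero] at h0
  rw [h0, one_mul, ← lintegral_const_mul' _ _ ENNReal.ofReal_ne_top,
    ← lintegral_add_left (by fun_prop)]
  exact congrArg _ (setLIntegral_congr_fun measurableSet_Ioc h2)

/-- The mild solution of the inhomogeneous heat equation, on the Fourier side. -/
def mild (ν : ℝ) (U₀ : R3 → C3) (F : ℝ → R3 → C3) (t : ℝ) (ξ : R3) : C3 :=
  heatSymbol ν t ξ • U₀ ξ + ∫ s in (0 : ℝ)..t, heatSymbol ν (t - s) ξ • F s ξ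

theorem continuous_heatSymbol (ν : ℝ) : Continuous fun p : ℝ × R3 => heatSymbol ν p.1 p.2 := by
  unfold heatSymbol
  fun_prop

theorem measurable_mild (ν : ℝ) {U₀ : R3 → C3} {F : ℝ → R3 → C3} (hU₀ : Measurable U₀)
    (hF : Measurable (Function.uncurry F)) : Measurable (Function.uncurry (mild ν U₀ F)) := by
  have hheat := (continuous_heatSymbol ν).measurable
  have hI : Measurable fun q : (ℝ × R3) × ℝ => heatSymbol ν (q.1.1 - q.2) q.1.2 • F q.2 q.1.2 := by
    have h1 : Measurable fun q : (ℝ × R3) × ℝ => heatSymbol ν (q.1.1 - q.2) q.1.2 :=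
      hheat.comp ((measurable_fst.fst.sub measurable_snd).prodMk measurable_fst.snd)
    exact h1.smul (hF.comp (measurable_snd.prodMk measurable_fst.snd))
  have h1 : MeasurableSet {q : (ℝ × R3) × ℝ | q.2 ∈ Ioc 0 q.1.1} :=
    (measurableSet_lt measurable_const measurable_snd).inter
      (measurableSet_le measurable_snd measurable_fst.fst)
  have h2 : MeasurableSet {q : (ℝ × R3) × ℝ | q.2 ∈ Ioc q.1.1 0} :=
    (measurableSet_lt measurable_fst.fst measurable_snd).inter
      (measurableSet_le measurable_snd measurable_const)
  have e1 := ((hI.indicator h1).stronglyMeasurable.integral_prod_right' (ν := volume)).measurable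
  have e2 := ((hI.indicator h2).stronglyMeasurable.integral_prod_right' (ν := volume)).measurable
  refine Measurable.add (hheat.smul (hU₀.comp measurable_snd)) ?_
  convert e1.sub e2 using 1
  ext1 p
  simp only [intervalIntegral, Pi.sub_apply]
  rw [← integral_indicator measurableSet_Ioc, ← integral_indicator measurableSet_Ioc]
  rfl

theorem enorm_mild_le (ν : ℝ) (U₀ : R3 → C3) (F : ℝ → R3 → C3) {t : ℝ} (ht : 0 ≤ t) (ξ : R3) :
    ‖mild ν U₀ F t ξ‖ₑ ≤
      ENNReal.ofReal (Real.exp (-(ν * (2 * Real.pi * ‖ξ‖) ^ 2) * t)) * ‖U₀ ξ‖ₑ +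
        ∫⁻ s in Ioc 0 t,
          ENNReal.ofReal (Real.exp (-(ν * (2 * Real.pi * ‖ξ‖) ^ 2) * (t - s))) * ‖F s ξ‖ₑ := by
  have hh : ∀ r, ‖heatSymbol ν r ξ‖ₑ =
      ENNReal.ofReal (Real.exp (-(ν * (2 * Real.pi * ‖ξ‖) ^ 2) * r)) := by
    intro r
    rw [← ofReal_norm, heatSymbol, Real.norm_eq_abs, abs_of_pos (Real.exp_pos _)]
    congr 2; ring
  refine (enorm_add_le _ _).trans (add_le_add ?_ ?_)
  · rw [enorm_smul, hh]
  · rw [intervalIntegral.integral_of_le ht]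
    refine (enorm_integral_le_lintegral_enorm _).trans (le_of_eq ?_)
    refine lintegral_congr fun s => ?_
    rw [enorm_smul, hh]

theorem lintegral_densityNorm {μ : Measure ℝ} [SFinite μ] (r : ℤ) {F : ℝ → R3 → C3}
    (hF : Measurable (Function.uncurry F)) :
    ∫⁻ s, densityNorm r (F s) ∂μ =
      ∫⁻ ξ, ENNReal.ofReal ((2 * Real.pi * ‖ξ‖) ^ r) * ∫⁻ s, ‖F s ξ‖ₑ ∂μ := by
  have hm : Measurable (Function.uncurry fun (s : ℝ) (ξ : R3) =>
      ENNReal.ofReal ((2 * Real.pi * ‖ξ‖) ^ r) * ‖F s ξ‖ₑ) :=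
    ((measurable_weight r).comp measurable_snd).mul hF.enorm
  simp only [densityNorm]
  rw [lintegral_lintegral_swap hm.aemeasurable]
  refine lintegral_congr fun ξ => ?_
  rw [lintegral_const_mul' _ _ ENNReal.ofReal_ne_top]

theorem measurable_densityNorm (r : ℤ) {F : ℝ → R3 → C3} (hF : Measurable (Function.uncurry F)) :
    Measurable fun s => densityNorm r (F s) := by
  have hm : Measurable (Function.uncurry fun (s : ℝ) (ξ : R3) =>
      ENNReal.ofReal ((2 * Real.pi * ‖ξ‖) ^ r) * ‖F s ξ‖ₑ) :=
    ((measurable_weight r).comp measurable_snd).mul hF.enorm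
  exact hm.lintegral_prod_right

/-- The a priori estimate for the inhomogeneous heat equation. -/
theorem mild_energy {ν : ℝ} (hν : 0 < ν) {U₀ : R3 → C3} {F : ℝ → R3 → C3} (hU₀ : Measurable U₀)
    (hF : Measurable (Function.uncurry F)) {t : ℝ} (ht : 0 ≤ t) :
    densityNorm (-1) (mild ν U₀ F t) +
        ENNReal.ofReal ν * ∫⁻ τ in Ioc 0 t, densityNorm 1 (mild ν U₀ F τ) ≤
      densityNorm (-1) U₀ + ∫⁻ s in Ioc 0 t, densityNorm (-1) (F s) := by
  have hM := measurable_mild ν hU₀ hF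
  rw [lintegral_densityNorm 1 hM, lintegral_densityNorm (-1) hF,
    ← lintegral_const_mul' _ _ ENNReal.ofReal_ne_top]
  simp only [densityNorm]
  have hMt : Measurable (mild ν U₀ F t) := hM.of_uncurry_left
  rw [← lintegral_add_left (measurable_weight_mul (-1) hMt.enorm),
    ← lintegral_add_left (measurable_weight_mul (-1) hU₀.enorm)]
  refine lintegral_mono_ae ?_
  have h0 : ∀ᵐ ξ : R3, ξ ≠ 0 := by simp [ae_iff]
  filter_upwards [h0] with ξ hξ
  set k := 2 * Real.pi * ‖ξ‖ with hk
  have hpos : 0 < k := by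
    have := norm_pos_iff.2 hξ
    positivity
  have e : ENNReal.ofReal ν * ENNReal.ofReal (k ^ (1 : ℤ)) =
      ENNReal.ofReal (k ^ (-1 : ℤ)) * ENNReal.ofReal (ν * k ^ 2) := by
    rw [← ENNReal.ofReal_mul hν.le, ← ENNReal.ofReal_mul (by positivity)]
    congr 1
    rw [zpow_neg_one, zpow_one]; field_simp
  rw [← mul_assoc, e, mul_assoc, ← mul_add, ← mul_add]
  refine mul_le_mul_right ?_ _
  have hG : Measurable fun s => ‖F s ξ‖ₑ :=
    hF.of_uncurry_right.enorm
  rw [← scalar_duhamel_identity (a := ν * k ^ 2) (by positivity) ‖U₀ ξ‖ₑ hG ht]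
  refine add_le_add (enorm_mild_le ν U₀ F ht ξ) (mul_le_mul_right ?_ _)
  exact setLIntegral_mono' measurableSet_Ioc fun τ hτ => enorm_mild_le ν U₀ F hτ.1.le ξ

theorem densityNorm_mild_le {ν : ℝ} (hν : 0 < ν) {U₀ : R3 → C3} {F : ℝ → R3 → C3}
    (hU₀ : Measurable U₀) (hF : Measurable (Function.uncurry F)) {t T : ℝ} (ht : 0 ≤ t)
    (htT : t ≤ T) :
    densityNorm (-1) (mild ν U₀ F t) ≤
      densityNorm (-1) U₀ + ∫⁻ s in Ioc 0 T, densityNorm (-1) (F s) :=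
  le_self_add.trans <| (mild_energy hν hU₀ hF ht).trans <|
    add_le_add le_rfl (lintegral_mono_set (Ioc_subset_Ioc_right htT))

theorem lintegral_sq_mild_le {ν : ℝ} (hν : 0 < ν) {U₀ : R3 → C3} {F : ℝ → R3 → C3}
    (hU₀ : Measurable U₀) (hF : Measurable (Function.uncurry F)) {T : ℝ} (hT : 0 ≤ T) :
    ENNReal.ofReal ν * ∫⁻ t in Ioc 0 T, densityNorm 0 (mild ν U₀ F t) ^ 2 ≤
      (densityNorm (-1) U₀ + ∫⁻ s in Ioc 0 T, densityNorm (-1) (F s)) ^ 2 := by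
  set K := densityNorm (-1) U₀ + ∫⁻ s in Ioc 0 T, densityNorm (-1) (F s) with hK
  have hM := measurable_mild ν hU₀ hF
  have h1 : ∫⁻ t in Ioc 0 T, densityNorm 0 (mild ν U₀ F t) ^ 2 ≤
      K * ∫⁻ t in Ioc 0 T, densityNorm 1 (mild ν U₀ F t) := by
    rw [← lintegral_const_mul _ (measurable_densityNorm 1 hM)]
    refine setLIntegral_mono' measurableSet_Ioc fun t ht => ?_
    refine (sq_densityNorm_zero_le (hM.of_uncurry_left)).trans ?_
    exact mul_le_mul_left (densityNorm_mild_le hν hU₀ hF ht.1.le ht.2) _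
  calc _ ≤ ENNReal.ofReal ν * (K * ∫⁻ t in Ioc 0 T, densityNorm 1 (mild ν U₀ F t)) :=
        mul_le_mul_right h1 _
    _ = K * (ENNReal.ofReal ν * ∫⁻ t in Ioc 0 T, densityNorm 1 (mild ν U₀ F t)) := by ring
    _ ≤ K * K := mul_le_mul_right (le_add_self.trans (mild_energy hν hU₀ hF hT)) _
    _ = K ^ 2 := (sq K).symm

theorem ae_integrableOn_of_densityNorm {F : ℝ → R3 → C3} (hF : Measurable (Function.uncurry F))
    {T : ℝ} (h : ∫⁻ s in Ioc 0 T, densityNorm (-1) (F s) ≠ ⊤) :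
    ∀ᵐ ξ, IntegrableOn (fun s => F s ξ) (Ioc 0 T) := by
  rw [lintegral_densityNorm (-1) hF] at h
  have hm : Measurable fun ξ => ∫⁻ s in Ioc 0 T, ‖F s ξ‖ₑ :=
    Measurable.lintegral_prod_left (f := fun s ξ => ‖F s ξ‖ₑ) hF.enorm
  have h0 : ∀ᵐ ξ : R3, ξ ≠ 0 := by simp [ae_iff]
  filter_upwards [ae_lt_top (measurable_weight_mul (-1) hm) h, h0] with ξ hξ h0
  have hFξ : Measurable fun s => F s ξ := hF.of_uncurry_right
  refine ⟨hFξ.aestronglyMeasurable, ?_⟩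
  refine lt_top_iff_ne_top.2 fun ht => ?_
  have hpos : 0 < (2 * Real.pi * ‖ξ‖) ^ (-1 : ℤ) := by
    have := norm_pos_iff.2 h0
    positivity
  have h3 : ∫⁻ s in Ioc 0 T, ‖F s ξ‖ₑ = ⊤ := ht
  rw [h3, ENNReal.mul_top (ENNReal.ofReal_pos.2 hpos).ne'] at hξ
  exact lt_irrefl _ hξ

theorem intervalIntegrable_heat_smul (ν : ℝ) {F : ℝ → R3 → C3} {T t : ℝ} {ξ : R3} (r : ℝ)
    (h : IntegrableOn (fun s => F s ξ) (Ioc 0 T)) (ht : 0 ≤ t) (htT : t ≤ T) :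
    IntervalIntegrable (fun s => heatSymbol ν (r - s) ξ • F s ξ) volume 0 t := by
  have h1 : IntervalIntegrable (fun s => F s ξ) volume 0 t :=
    (intervalIntegrable_iff_integrableOn_Ioc_of_le ht).2 (h.mono_set (Ioc_subset_Ioc_right htT))
  refine h1.continuousOn_smul (Continuous.continuousOn ?_)
  exact (continuous_heatSymbol ν).comp (by fun_prop : Continuous fun s => (r - s, ξ))

theorem mild_sub_mild (ν : ℝ) (U₀ : R3 → C3) {F G : ℝ → R3 → C3} {T t : ℝ} {ξ : R3}
    (hF : IntegrableOn (fun s => F s ξ) (Ioc 0 T)) (hG : IntegrableOn (fun s => G s ξ) (Ioc 0 T))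
    (ht : 0 ≤ t) (htT : t ≤ T) :
    mild ν U₀ F t ξ - mild ν U₀ G t ξ = mild ν (fun _ => 0) (fun s ξ => F s ξ - G s ξ) t ξ := by
  simp only [mild, smul_zero, zero_add, smul_sub]
  rw [intervalIntegral.integral_sub (intervalIntegrable_heat_smul ν t hF ht htT)
    (intervalIntegrable_heat_smul ν t hG ht htT)]
  abel

theorem mild_congr (ν : ℝ) (U₀ : R3 → C3) {F G : ℝ → R3 → C3} {T t : ℝ}
    (h : ∀ᵐ s ∂(volume.restrict (Ioc 0 T)), F s = G s) (ht : 0 ≤ t) (htT : t ≤ T) :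
    mild ν U₀ F t = mild ν U₀ G t := by
  ext1 ξ
  simp only [mild]
  congr 1
  rw [intervalIntegral.integral_of_le ht, intervalIntegral.integral_of_le ht]
  refine integral_congr_ae ?_
  filter_upwards [ae_restrict_of_ae_restrict_of_subset (Ioc_subset_Ioc_right htT) h] with s hs
  rw [hs]

theorem mild_congr_data (ν : ℝ) {U₀ U₁ : R3 → C3} (h : U₀ =ᵐ[volume] U₁) (F : ℝ → R3 → C3)
    (t : ℝ) : mild ν U₀ F t =ᵐ[volume] mild ν U₁ F t :=
  h.mono fun ξ hξ => by simp only [mild, hξ]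

theorem mild_zero_time (ν : ℝ) (U₀ : R3 → C3) (F : ℝ → R3 → C3) : mild ν U₀ F 0 = U₀ := by
  ext1 ξ
  simp [mild, heatSymbol]

theorem continuousOn_mild (ν : ℝ) (U₀ : R3 → C3) {F : ℝ → R3 → C3} {T : ℝ} {ξ : R3}
    (hT : 0 ≤ T) (hF : IntegrableOn (fun s => F s ξ) (Ioc 0 T)) :
    ContinuousOn (fun t => mild ν U₀ F t ξ) (Icc 0 T) := by
  have e : ∀ t, mild ν U₀ F t ξ = heatSymbol ν t ξ • U₀ ξ +
      heatSymbol ν t ξ • ∫ s in (0 : ℝ)..t, heatSymbol ν (0 - s) ξ • F s ξ := by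
    intro t
    rw [mild, ← intervalIntegral.integral_smul]
    congr 1
    refine intervalIntegral.integral_congr fun s _ => ?_
    simp only [smul_smul]
    congr 1
    rw [heatSymbol, heatSymbol, heatSymbol, ← Real.exp_add]
    congr 1; ring
  simp_rw [e]
  have hc : Continuous fun t => heatSymbol ν t ξ :=
    (continuous_heatSymbol ν).comp (by fun_prop : Continuous fun s => (s, ξ))
  have hp : ContinuousOn (fun t => ∫ s in (0 : ℝ)..t, heatSymbol ν (0 - s) ξ • F s ξ)
      (Icc 0 T) := by
    have := intervalIntegral.continuousOn_primitive_interval'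
      (intervalIntegrable_heat_smul ν 0 hF hT le_rfl) left_mem_uIcc
    rwa [uIcc_of_le hT] at this
  exact (hc.smul continuous_const).continuousOn.add (hc.continuousOn.smul hp)

theorem enorm_mild_le_add {ν : ℝ} (hν : 0 < ν) (U₀ : R3 → C3) (F : ℝ → R3 → C3) {t T : ℝ}
    (ht : 0 ≤ t) (htT : t ≤ T) (ξ : R3) :
    ‖mild ν U₀ F t ξ‖ₑ ≤ ‖U₀ ξ‖ₑ + ∫⁻ s in Ioc 0 T, ‖F s ξ‖ₑ := by
  have h1 : ∀ r : ℝ, 0 ≤ r →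
      ENNReal.ofReal (Real.exp (-(ν * (2 * Real.pi * ‖ξ‖) ^ 2) * r)) ≤ 1 := by
    intro r hr
    rw [← ENNReal.ofReal_one]
    refine ENNReal.ofReal_le_ofReal (Real.exp_le_one_iff.2 ?_)
    have : 0 ≤ ν * (2 * Real.pi * ‖ξ‖) ^ 2 * r := by positivity
    linarith
  refine (enorm_mild_le ν U₀ F ht ξ).trans (add_le_add ?_ ?_)
  · exact (mul_le_mul_left (h1 t ht) _).trans (one_mul _).le
  · refine le_trans ?_ (lintegral_mono_set (Ioc_subset_Ioc_right htT))
    refine setLIntegral_mono' measurableSet_Ioc fun s hs => ?_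
    exact (mul_le_mul_left (h1 _ (sub_nonneg.2 hs.2)) _).trans (one_mul _).le

theorem tendsto_densityNorm_mild_sub {ν : ℝ} (hν : 0 < ν) {U₀ : R3 → C3} {F : ℝ → R3 → C3}
    (hU₀ : Measurable U₀) (hF : Measurable (Function.uncurry F)) {T : ℝ}
    (h0 : densityNorm (-1) U₀ ≠ ⊤) (h : ∫⁻ s in Ioc 0 T, densityNorm (-1) (F s) ≠ ⊤)
    {t : ℝ} (ht : t ∈ Icc 0 T) :
    Tendsto (fun τ => densityNorm (-1) (fun ξ => mild ν U₀ F τ ξ - mild ν U₀ F t ξ))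
      (𝓝[Icc 0 T] t) (𝓝 0) := by
  have hM := measurable_mild ν hU₀ hF
  have hMt : ∀ τ, Measurable (mild ν U₀ F τ) := fun τ =>
    hM.of_uncurry_left
  have hm : Measurable fun ξ => ∫⁻ s in Ioc 0 T, ‖F s ξ‖ₑ :=
    Measurable.lintegral_prod_left (f := fun s ξ => ‖F s ξ‖ₑ) hF.enorm
  have key := tendsto_lintegral_filter_of_dominated_convergence (μ := (volume : Measure R3))
    (l := 𝓝[Icc 0 T] t)
    (F := fun τ ξ => ENNReal.ofReal ((2 * Real.pi * ‖ξ‖) ^ (-1 : ℤ)) *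
      ‖mild ν U₀ F τ ξ - mild ν U₀ F t ξ‖ₑ) (f := fun _ => 0)
    (fun ξ => 2 * (ENNReal.ofReal ((2 * Real.pi * ‖ξ‖) ^ (-1 : ℤ)) * ‖U₀ ξ‖ₑ +
      ENNReal.ofReal ((2 * Real.pi * ‖ξ‖) ^ (-1 : ℤ)) * ∫⁻ s in Ioc 0 T, ‖F s ξ‖ₑ))
    (.of_forall fun τ => measurable_weight_mul (-1) ((hMt τ).sub (hMt t)).enorm) ?_ ?_ ?_
  · rwa [lintegral_zero] at key
  · filter_upwards [self_mem_nhdsWithin] with τ hτ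
    refine .of_forall fun ξ => ?_
    rw [← mul_add, mul_left_comm]
    refine mul_le_mul_right ?_ _
    refine (enorm_sub_le).trans ?_
    rw [two_mul]
    exact add_le_add (enorm_mild_le_add hν U₀ F hτ.1 hτ.2 ξ)
      (enorm_mild_le_add hν U₀ F ht.1 ht.2 ξ)
  · rw [lintegral_const_mul' _ _ (by simp), lintegral_add_left
      (measurable_weight_mul (-1) hU₀.enorm), ← lintegral_densityNorm (-1) hF]
    exact ENNReal.mul_ne_top (by simp) (ENNReal.add_ne_top.2 ⟨h0, h⟩)
  · filter_upwards [ae_integrableOn_of_densityNorm hF h] with ξ hξ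
    have hc := (continuousOn_mild ν U₀ (ht.1.trans ht.2) hξ) t ht
    have h1 : Tendsto (fun τ => ‖mild ν U₀ F τ ξ - mild ν U₀ F t ξ‖ₑ) (𝓝[Icc 0 T] t) (𝓝 0) := by
      have := (hc.sub (continuousWithinAt_const (b := mild ν U₀ F t ξ))).enorm
      simpa [ContinuousWithinAt] using this
    have h2 := ENNReal.Tendsto.const_mul (a := ENNReal.ofReal ((2 * Real.pi * ‖ξ‖) ^ (-1 : ℤ))) h1
      (Or.inr ENNReal.ofReal_ne_top)
    rwa [mul_zero] at h2

theorem add_sq_le_two_mul_add (a b : ℝ≥0∞) : (a + b) ^ 2 ≤ 2 * a ^ 2 + 2 * b ^ 2 := by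
  by_cases ha : a = ⊤
  · simp [ha]
  by_cases hb : b = ⊤
  · simp [hb]
  lift a to NNReal using ha
  lift b to NNReal using hb
  norm_cast
  rw [← NNReal.coe_le_coe]
  push_cast
  nlinarith [sq_nonneg ((a : ℝ) - b)]

theorem densityNorm_zero_sub_le {U V W : R3 → C3} (hU : Measurable U) (hV : Measurable V) :
    densityNorm 0 (fun ξ => U ξ - W ξ) ≤
      densityNorm 0 (fun ξ => U ξ - V ξ) + densityNorm 0 (fun ξ => V ξ - W ξ) := by
  simp only [densityNorm_zero]
  have hm : Measurable fun ξ => ‖U ξ - V ξ‖ₑ := (hU.sub hV).enorm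
  rw [← lintegral_add_left hm]
  refine lintegral_mono fun ξ => ?_
  rw [← sub_add_sub_cancel (U ξ) (V ξ) (W ξ)]
  exact enorm_add_le _ _

theorem lintegral_sq_densityNorm_sub_le {μ : Measure ℝ} {U V W : ℝ → R3 → C3}
    (hU : Measurable (Function.uncurry U)) (hV : Measurable (Function.uncurry V)) :
    ∫⁻ t, densityNorm 0 (fun ξ => U t ξ - W t ξ) ^ 2 ∂μ ≤
      2 * (∫⁻ t, densityNorm 0 (fun ξ => U t ξ - V t ξ) ^ 2 ∂μ) +
        2 * ∫⁻ t, densityNorm 0 (fun ξ => V t ξ - W t ξ) ^ 2 ∂μ := by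
  have hm : Measurable fun t => densityNorm 0 (fun ξ => U t ξ - V t ξ) :=
    measurable_densityNorm (F := fun t ξ => U t ξ - V t ξ) 0 (hU.sub hV)
  rw [← lintegral_const_mul' _ _ (by simp), ← lintegral_const_mul' _ _ (by simp),
    ← lintegral_add_left ((hm.pow_const 2).const_mul 2)]
  refine lintegral_mono fun t => ?_
  exact (pow_le_pow_left' (densityNorm_zero_sub_le hU.of_uncurry_left hV.of_uncurry_left) 2).trans
    (add_sq_le_two_mul_add _ _)

theorem ae_eq_of_densityNorm_zero {V W : R3 → C3} (hV : Measurable V) (hW : Measurable W)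
    (h : densityNorm 0 (fun ξ => V ξ - W ξ) = 0) : V =ᵐ[volume] W := by
  have hm : Measurable fun ξ => ‖V ξ - W ξ‖ₑ := (hV.sub hW).enorm
  rw [densityNorm_zero, lintegral_eq_zero_iff hm] at h
  exact h.mono fun ξ hξ => sub_eq_zero.1 (enorm_eq_zero.1 hξ)

theorem densityNorm_sub_eq_zero {V W : R3 → C3} (r : ℤ) (h : V =ᵐ[volume] W) :
    densityNorm r (fun ξ => V ξ - W ξ) = 0 := by
  have : (fun ξ => V ξ - W ξ) =ᵐ[volume] fun _ => 0 :=
    h.mono fun ξ hξ => by simp only [hξ, sub_self]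
  rw [densityNorm_congr this]
  simp [densityNorm]

/-- The nonlinear term along a curve. -/
def forcing (U : ℝ → R3 → C3) (s : ℝ) : R3 → C3 := nonlinearHat (U s)

theorem measurable_forcing {U : ℝ → R3 → C3} (hU : Measurable (Function.uncurry U)) :
    Measurable (Function.uncurry (forcing U)) :=
  measurable_nonlinearHat hU

theorem lintegral_forcing_le {U : ℝ → R3 → C3} (hU : Measurable (Function.uncurry U))
    (μ : Measure ℝ) :
    ∫⁻ s, densityNorm (-1) (forcing U s) ∂μ ≤ ∫⁻ s, densityNorm 0 (U s) ^ 2 ∂μ :=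
  lintegral_mono fun _ => densityNorm_nonlinearHat_le hU.of_uncurry_left

theorem ae_densityNorm_ne_top {U : ℝ → R3 → C3} (hU : Measurable (Function.uncurry U))
    {μ : Measure ℝ} (h : ∫⁻ s, densityNorm 0 (U s) ^ 2 ∂μ ≠ ⊤) :
    ∀ᵐ s ∂μ, densityNorm 0 (U s) ≠ ⊤ := by
  refine (ae_lt_top ((measurable_densityNorm 0 hU).pow_const 2) h).mono fun s hs h => ?_
  rw [h] at hs
  simp at hs

theorem lintegral_Ioc_add {f : ℝ → ℝ≥0∞} {a b c : ℝ} (hab : a ≤ b) (hbc : b ≤ c) :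
    ∫⁻ t in Ioc a c, f t = (∫⁻ t in Ioc a b, f t) + ∫⁻ t in Ioc b c, f t := by
  rw [← Ioc_union_Ioc_eq_Ioc hab hbc,
    lintegral_union measurableSet_Ioc (Ioc_disjoint_Ioc_of_le le_rfl)]

/-- Two curves which agree up to time `a` have close images under the Duhamel map after `a`. -/
theorem lintegral_sq_mild_sub_le {ν : ℝ} (hν : 0 < ν) (U₀ : R3 → C3)
    {U V : ℝ → R3 → C3} (hU : Measurable (Function.uncurry U))
    (hV : Measurable (Function.uncurry V)) {a T : ℝ} (ha : 0 ≤ a) (haT : a ≤ T)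
    (hUf : ∫⁻ t in Ioc 0 T, densityNorm 0 (U t) ^ 2 ≠ ⊤)
    (hVf : ∫⁻ t in Ioc 0 T, densityNorm 0 (V t) ^ 2 ≠ ⊤)
    (h : ∀ᵐ t ∂(volume.restrict (Ioc 0 a)), U t =ᵐ[volume] V t) :
    ∫⁻ t in Ioc a T, densityNorm 0
        (fun ξ => mild ν U₀ (forcing U) t ξ - mild ν U₀ (forcing V) t ξ) ^ 2 ≤
      (ENNReal.ofReal ν)⁻¹ * ((∫⁻ t in Ioc a T, (densityNorm 0 (U t) + densityNorm 0 (V t)) ^ 2) *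
        ∫⁻ t in Ioc a T, densityNorm 0 (fun ξ => U t ξ - V t ξ) ^ 2) := by
  have hFU := measurable_forcing hU
  have hFV := measurable_forcing hV
  have iU := ae_integrableOn_of_densityNorm hFU
    (ne_top_of_le_ne_top hUf (lintegral_forcing_le hU _))
  have iV := ae_integrableOn_of_densityNorm hFV
    (ne_top_of_le_ne_top hVf (lintegral_forcing_le hV _))
  set F : ℝ → R3 → C3 := fun s ξ => forcing U s ξ - forcing V s ξ with hFdef
  have hF : Measurable (Function.uncurry F) := hFU.sub hFV
  have e1 : ∫⁻ t in Ioc a T, densityNorm 0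
        (fun ξ => mild ν U₀ (forcing U) t ξ - mild ν U₀ (forcing V) t ξ) ^ 2 ≤
      ∫⁻ t in Ioc 0 T, densityNorm 0 (mild ν (fun _ => 0) F t) ^ 2 := by
    refine le_trans (le_of_eq ?_) (lintegral_mono_set (Ioc_subset_Ioc_left ha))
    refine setLIntegral_congr_fun measurableSet_Ioc fun t ht => ?_
    have : (fun ξ => mild ν U₀ (forcing U) t ξ - mild ν U₀ (forcing V) t ξ)
        =ᵐ[volume] mild ν (fun _ => 0) F t := by
      filter_upwards [iU, iV] with ξ h1 h2
      exact mild_sub_mild ν U₀ h1 h2 (ha.trans ht.1.le) ht.2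
    simp only [densityNorm_congr this]
  have e2 := lintegral_sq_mild_le hν (U₀ := fun _ => 0) measurable_const hF (ha.trans haT)
  have e3 : densityNorm (-1) (fun _ => 0) = 0 := by simp [densityNorm]
  rw [e3, zero_add, lintegral_Ioc_add (f := fun s => densityNorm (-1) (F s)) ha haT] at e2
  have e4 : ∫⁻ s in Ioc 0 a, densityNorm (-1) (F s) = 0 := by
    rw [lintegral_eq_zero_iff (measurable_densityNorm (-1) hF)]
    filter_upwards [h] with s hs
    refine densityNorm_sub_eq_zero (-1) ?_
    rw [forcing, forcing, nonlinearHat_congr hs]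
  rw [e4, zero_add] at e2
  have mU := measurable_densityNorm 0 hU
  have mV := measurable_densityNorm 0 hV
  have mD : Measurable fun t => densityNorm 0 (fun ξ => U t ξ - V t ξ) :=
    measurable_densityNorm (F := fun t ξ => U t ξ - V t ξ) 0 (hU.sub hV)
  have e5 : (∫⁻ s in Ioc a T, densityNorm (-1) (F s)) ^ 2 ≤
      (∫⁻ t in Ioc a T, (densityNorm 0 (U t) + densityNorm 0 (V t)) ^ 2) *
        ∫⁻ t in Ioc a T, densityNorm 0 (fun ξ => U t ξ - V t ξ) ^ 2 := by
    refine sq_lintegral_le ((mU.add mV).pow_const 2).aemeasurable (mD.pow_const 2).aemeasurable ?_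
    have hs := Ioc_subset_Ioc_left (b := T) ha
    filter_upwards [ae_restrict_of_ae_restrict_of_subset hs (ae_densityNorm_ne_top hU hUf),
      ae_restrict_of_ae_restrict_of_subset hs (ae_densityNorm_ne_top hV hVf)] with s h1 h2
    rw [← mul_pow]
    exact pow_le_pow_left' (densityNorm_nonlinearHat_sub_le hU.of_uncurry_left
      hV.of_uncurry_left h1 h2) 2
  have hν0 : ENNReal.ofReal ν ≠ 0 := (ENNReal.ofReal_pos.2 hν).ne'
  rw [← ENNReal.mul_le_iff_le_inv hν0 ENNReal.ofReal_ne_top]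
  exact (mul_le_mul_right e1 _).trans (e2.trans e5)

/-- Fourier side of a mild solution in `L²([0,T]; χ⁰)`. -/
structure FourierSolution (ν : ℝ) (U₀ : R3 → C3) (T : ℝ) (U : ℝ → R3 → C3) : Prop where
  meas : Measurable (Function.uncurry U)
  sq_ne_top : ∫⁻ t in Ioc 0 T, densityNorm 0 (U t) ^ 2 ≠ ⊤
  eq_mild : ∀ᵐ t ∂(volume.restrict (Ioc 0 T)), U t =ᵐ[volume] mild ν U₀ (forcing U) t

theorem FourierSolution.mono {ν : ℝ} {U₀ : R3 → C3} {T T' : ℝ} {U : ℝ → R3 → C3}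
    (h : FourierSolution ν U₀ T U) (hT : T' ≤ T) : FourierSolution ν U₀ T' U where
  meas := h.meas
  sq_ne_top := ne_top_of_le_ne_top h.sq_ne_top (lintegral_mono_set (Ioc_subset_Ioc_right hT))
  eq_mild := ae_restrict_of_ae_restrict_of_subset (Ioc_subset_Ioc_right hT) h.eq_mild

theorem FourierSolution.congr {ν : ℝ} {U₀ : R3 → C3} {T : ℝ} {U V : ℝ → R3 → C3}
    (h : FourierSolution ν U₀ T U) (hV : Measurable (Function.uncurry V))
    (hUV : ∀ᵐ t ∂(volume.restrict (Ioc 0 T)), U t =ᵐ[volume] V t) :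
    FourierSolution ν U₀ T V where
  meas := hV
  sq_ne_top := by
    rw [← lintegral_congr_ae (f := fun t => densityNorm 0 (U t) ^ 2)
      (hUV.mono fun t ht => by simp only [densityNorm_congr ht])]
    exact h.sq_ne_top
  eq_mild := by
    have hF : ∀ᵐ s ∂(volume.restrict (Ioc 0 T)), forcing U s = forcing V s :=
      hUV.mono fun s hs => nonlinearHat_congr hs
    filter_upwards [hUV, h.eq_mild, ae_restrict_mem measurableSet_Ioc] with t h1 h2 h3
    rw [← mild_congr ν U₀ hF h3.1.le h3.2]
    exact h1.symm.trans h2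

theorem eq_zero_of_le_half {x c : ℝ≥0∞} (hx : x ≠ ⊤) (hc : c ≤ 2⁻¹) (h : x ≤ c * x) : x = 0 := by
  by_contra h0
  have h1 : x ≤ x / 2 := by
    refine h.trans ((mul_le_mul_left hc _).trans_eq ?_)
    rw [mul_comm, ENNReal.div_eq_inv_mul, mul_comm]
  exact (ENNReal.half_lt_self h0 hx).not_ge h1

theorem lintegral_sq_add_ne_top {U V : ℝ → R3 → C3} {μ : Measure ℝ}
    (hU : Measurable (Function.uncurry U))
    (hUf : ∫⁻ t, densityNorm 0 (U t) ^ 2 ∂μ ≠ ⊤) (hVf : ∫⁻ t, densityNorm 0 (V t) ^ 2 ∂μ ≠ ⊤) :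
    ∫⁻ t, (densityNorm 0 (U t) + densityNorm 0 (V t)) ^ 2 ∂μ ≠ ⊤ := by
  have mU := measurable_densityNorm 0 hU
  refine ne_top_of_le_ne_top ?_ (lintegral_mono fun t => add_sq_le_two_mul_add _ _)
  rw [lintegral_add_left ((mU.pow_const 2).const_mul 2), lintegral_const_mul' _ _ (by simp),
    lintegral_const_mul' _ _ (by simp)]
  exact ENNReal.add_ne_top.2 ⟨ENNReal.mul_ne_top (by simp) hUf, ENNReal.mul_ne_top (by simp) hVf⟩

theorem densityNorm_zero_sub_le_add {U V : R3 → C3} (hU : Measurable U) :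
    densityNorm 0 (fun ξ => U ξ - V ξ) ≤ densityNorm 0 U + densityNorm 0 V := by
  simp only [densityNorm_zero]
  rw [← lintegral_add_left hU.enorm]
  exact lintegral_mono fun ξ => enorm_sub_le

theorem FourierSolution.ae_eq {ν : ℝ} (hν : 0 < ν) {U₀ : R3 → C3}
    {T : ℝ} (hT : 0 ≤ T) {U V : ℝ → R3 → C3}
    (hU : FourierSolution ν U₀ T U) (hV : FourierSolution ν U₀ T V) :
    ∀ᵐ t ∂(volume.restrict (Ioc 0 T)), U t =ᵐ[volume] V t := by
  have hν0 : ENNReal.ofReal ν ≠ 0 := (ENNReal.ofReal_pos.2 hν).ne'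
  have mD : Measurable fun t => densityNorm 0 (fun ξ => U t ξ - V t ξ) :=
    measurable_densityNorm (F := fun t ξ => U t ξ - V t ξ) 0 (hU.meas.sub hV.meas)
  have hfin := lintegral_sq_add_ne_top (V := V) hU.meas hU.sq_ne_top hV.sq_ne_top
  have hDfin : ∫⁻ t in Ioc 0 T, densityNorm 0 (fun ξ => U t ξ - V t ξ) ^ 2 ≠ ⊤ :=
    ne_top_of_le_ne_top hfin (lintegral_mono fun t =>
      pow_le_pow_left' (densityNorm_zero_sub_le_add hU.meas.of_uncurry_left) 2)
  obtain ⟨δ, hδ, hsmall⟩ := exists_pos_setLIntegral_lt_of_measure_lt hfin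
    (ε := ENNReal.ofReal ν / 2) (ENNReal.div_pos hν0 (by simp)).ne'
  obtain ⟨d, hd0, hdδ⟩ : ∃ d : ℝ, 0 < d ∧ ENNReal.ofReal d < δ := by
    obtain ⟨r, hr0, hr⟩ := ENNReal.lt_iff_exists_nnreal_btwn.1 hδ
    exact ⟨r, by simpa using hr0, by simpa using hr⟩
  have toAe : ∀ b, ∫⁻ t in Ioc 0 b, densityNorm 0 (fun ξ => U t ξ - V t ξ) ^ 2 = 0 →
      ∀ᵐ t ∂(volume.restrict (Ioc 0 b)), U t =ᵐ[volume] V t := by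
    intro b hb
    rw [lintegral_eq_zero_iff (mD.pow_const 2)] at hb
    filter_upwards [hb] with t ht
    exact ae_eq_of_densityNorm_zero hU.meas.of_uncurry_left hV.meas.of_uncurry_left
      (by simpa using ht)
  have step : ∀ n : ℕ,
      ∫⁻ t in Ioc 0 (min T (n * d)), densityNorm 0 (fun ξ => U t ξ - V t ξ) ^ 2 = 0 := by
    intro n
    induction n with
    | zero => simp [hT]
    | succ n ih =>
      set a := min T (n * d) with ha
      set b := min T ((n + 1 : ℕ) * d) with hb
      have hnd : (0 : ℝ) ≤ n * d := by positivity
      have ha0 : 0 ≤ a := le_min hT hnd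
      have hab : a ≤ b := min_le_min le_rfl (by push_cast; nlinarith)
      have hbT : b ≤ T := min_le_left _ _
      have hba : b - a ≤ d := by
        rw [hb, ha]
        push_cast
        rcases le_total T (n * d) with h | h
        · rw [min_eq_left h]
          exact (sub_le_sub_right (min_le_left _ _) _).trans (by linarith)
        · rw [min_eq_right h]
          have := min_le_right T (((n : ℝ) + 1) * d)
          linarith
      have hUb := hU.mono hbT
      have hVb := hV.mono hbT
      have key := lintegral_sq_mild_sub_le hν U₀ hU.meas hV.meas ha0 hab hUb.sq_ne_top
        hVb.sq_ne_top (toAe a ih)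
      have hsub : Ioc a b ⊆ Ioc 0 T := Ioc_subset_Ioc ha0 hbT
      have hlhs : ∫⁻ t in Ioc a b, densityNorm 0
            (fun ξ => mild ν U₀ (forcing U) t ξ - mild ν U₀ (forcing V) t ξ) ^ 2 =
          ∫⁻ t in Ioc a b, densityNorm 0 (fun ξ => U t ξ - V t ξ) ^ 2 := by
        refine lintegral_congr_ae ?_
        filter_upwards [ae_restrict_of_ae_restrict_of_subset hsub hU.eq_mild,
          ae_restrict_of_ae_restrict_of_subset hsub hV.eq_mild] with t h1 h2
        have : (fun ξ => mild ν U₀ (forcing U) t ξ - mild ν U₀ (forcing V) t ξ)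
            =ᵐ[volume] fun ξ => U t ξ - V t ξ := by
          filter_upwards [h1, h2] with ξ h1 h2
          rw [h1, h2]
        simp only [densityNorm_congr this]
      rw [hlhs, ← mul_assoc] at key
      have hG : ∫⁻ t in Ioc a b, (densityNorm 0 (U t) + densityNorm 0 (V t)) ^ 2 ≤
          ENNReal.ofReal ν / 2 := by
        have hv : (volume.restrict (Ioc 0 T)) (Ioc a b) < δ := by
          refine (Measure.restrict_apply_le _ _).trans_lt ?_
          rw [Real.volume_Ioc]
          exact (ENNReal.ofReal_le_ofReal hba).trans_lt hdδ
        have := hsmall _ hv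
        rw [Measure.restrict_restrict measurableSet_Ioc, inter_eq_left.2 hsub] at this
        exact this.le
      have hc : (ENNReal.ofReal ν)⁻¹ *
          (∫⁻ t in Ioc a b, (densityNorm 0 (U t) + densityNorm 0 (V t)) ^ 2) ≤ 2⁻¹ := by
        refine (mul_le_mul_right hG _).trans_eq ?_
        rw [div_eq_mul_inv, ← mul_assoc, ENNReal.inv_mul_cancel hν0 ENNReal.ofReal_ne_top, one_mul]
      have hx := eq_zero_of_le_half
        (ne_top_of_le_ne_top hDfin (lintegral_mono_set hsub)) hc key
      rw [lintegral_Ioc_add ha0 hab, ih, hx, add_zero]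
  obtain ⟨n, hn⟩ := exists_nat_ge (T / d)
  have := step n
  rw [min_eq_left ((div_le_iff₀ hd0).1 hn)] at this
  exact toAe T this

theorem sq_tsum_le (q : ℕ → ℝ≥0∞) : (∑' m, q m) ^ 2 ≤ 2 * ∑' m, 2 ^ m * q m ^ 2 := by
  have := sq_lintegral_le (μ := Measure.count) (f := fun m : ℕ => (2⁻¹ : ℝ≥0∞) ^ m)
    (g := fun m => 2 ^ m * q m ^ 2) (h := q) (by fun_prop) (by fun_prop) (.of_forall fun m => by
      rw [← mul_assoc, ← mul_pow, ENNReal.inv_mul_cancel (by simp) (by simp), one_pow, one_mul])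
  rw [lintegral_count, lintegral_count, lintegral_count, ENNReal.tsum_geometric] at this
  simpa using this

theorem lintegral_sq_tsum_le {μ : Measure ℝ} {q : ℕ → ℝ → ℝ≥0∞} (hq : ∀ m, Measurable (q m))
    {C : ℝ≥0∞} (h : ∀ m, ∫⁻ t, q m t ^ 2 ∂μ ≤ C * (4⁻¹) ^ m) :
    ∫⁻ t, (∑' m, q m t) ^ 2 ∂μ ≤ 4 * C := by
  calc ∫⁻ t, (∑' m, q m t) ^ 2 ∂μ ≤ ∫⁻ t, 2 * ∑' m, 2 ^ m * q m t ^ 2 ∂μ :=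
        lintegral_mono fun t => sq_tsum_le _
    _ = 2 * ∑' m, 2 ^ m * ∫⁻ t, q m t ^ 2 ∂μ := by
        rw [lintegral_const_mul' _ _ (by simp),
          lintegral_tsum fun m => (((hq m).pow_const 2).const_mul _).aemeasurable]
        congr 2
        ext m
        rw [lintegral_const_mul' _ _ (by simp)]
    _ ≤ 2 * ∑' m, C * (2⁻¹) ^ m := by
        refine mul_le_mul_right (ENNReal.tsum_le_tsum fun m => ?_) _
        refine (mul_le_mul_right (h m) _).trans_eq ?_
        rw [mul_left_comm, ← mul_pow]
        congr 2
        rw [show (4 : ℝ≥0∞) = 2 * 2 by norm_num, ENNReal.mul_inv (by simp) (by simp), ← mul_assoc,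
          ENNReal.mul_inv_cancel (by simp) (by simp), one_mul]
    _ = 4 * C := by
        rw [ENNReal.tsum_mul_left, ENNReal.tsum_geometric]
        simp only [ENNReal.one_sub_inv_two, inv_inv]
        ring

theorem exists_limit_of_geometric {μ : Measure ℝ} {V : ℕ → ℝ → R3 → C3}
    (hV : ∀ n, Measurable (Function.uncurry (V n))) {C : ℝ≥0∞} (hC : C ≠ ⊤)
    (h : ∀ n, ∫⁻ t, densityNorm 0 (fun ξ => V n t ξ - V (n + 1) t ξ) ^ 2 ∂μ ≤ C * (4⁻¹) ^ n) :
    ∃ W : ℝ → R3 → C3, Measurable (Function.uncurry W) ∧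
      ∀ n, ∫⁻ t, densityNorm 0 (fun ξ => V n t ξ - W t ξ) ^ 2 ∂μ ≤ 4 * (C * (4⁻¹) ^ n) := by
  set q : ℕ → ℝ → ℝ≥0∞ := fun n t => densityNorm 0 (fun ξ => V n t ξ - V (n + 1) t ξ) with hq
  have hd : ∀ n, Measurable (Function.uncurry fun t ξ => V n t ξ - V (n + 1) t ξ) :=
    fun n => (hV n).sub (hV (n + 1))
  have hqm : ∀ n, Measurable (q n) := fun n => measurable_densityNorm 0 (hd n)
  refine ⟨fun t ξ => limUnder atTop fun n => V n t ξ, ?_, fun n => ?_⟩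
  · exact (StronglyMeasurable.limUnder (l := atTop)
      fun n => (hV n).stronglyMeasurable).measurable
  have hfin : ∀ᵐ t ∂μ, ∑' m, q m t ≠ ⊤ := by
    have h1 := lintegral_sq_tsum_le hqm h
    have h2 := ae_lt_top ((Measurable.tsum hqm).pow_const 2)
      (ne_top_of_le_ne_top (ENNReal.mul_ne_top (by simp) hC) h1)
    refine h2.mono fun t ht h => ?_
    rw [h] at ht
    simp at ht
  have hle : ∀ᵐ t ∂μ, densityNorm 0 (fun ξ => V n t ξ - limUnder atTop fun m => V m t ξ) ≤
      ∑' m, q (n + m) t := by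
    filter_upwards [hfin] with t ht
    have hdm : ∀ m, Measurable fun ξ => ‖V m t ξ - V (m + 1) t ξ‖ₑ := fun m =>
      ((hd m).of_uncurry_left (x := t)).enorm
    have hξ : ∀ᵐ ξ, ∑' m, ‖V m t ξ - V (m + 1) t ξ‖ₑ ≠ ⊤ := by
      refine (ae_lt_top (Measurable.tsum hdm) ?_).mono fun ξ h => h.ne
      rw [lintegral_tsum fun m => (hdm m).aemeasurable]
      simpa only [hq, densityNorm_zero] using ht
    simp only [hq, densityNorm_zero]
    rw [← lintegral_tsum fun m => (hdm _).aemeasurable]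
    refine lintegral_mono_ae (hξ.mono fun ξ hξ => ?_)
    have hed : ∀ m, edist (V m t ξ) (V m.succ t ξ) ≤ ‖V m t ξ - V (m + 1) t ξ‖ₑ := fun m => by
      rw [edist_eq_enorm_sub]
    have hc := (cauchySeq_of_edist_le_of_tsum_ne_top _ hed hξ).tendsto_limUnder
    have := edist_le_tsum_of_edist_le_of_tendsto _ hed hc n
    rwa [edist_eq_enorm_sub] at this
  refine (lintegral_mono_ae (hle.mono fun t ht => pow_le_pow_left' ht 2)).trans ?_
  refine lintegral_sq_tsum_le (fun m => hqm (n + m)) fun m => (h (n + m)).trans_eq ?_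
  rw [pow_add, mul_assoc]

theorem densityNorm_sub_comm (r : ℤ) (V W : R3 → C3) :
    densityNorm r (fun ξ => V ξ - W ξ) = densityNorm r (fun ξ => W ξ - V ξ) := by
  simp only [densityNorm, enorm_sub_rev]

/-- The curve which follows `U` up to time `a` and `W` afterwards. -/
def glue (a : ℝ) (U W : ℝ → R3 → C3) (t : ℝ) : R3 → C3 := if t ≤ a then U t else W t

theorem measurable_glue (a : ℝ) {U W : ℝ → R3 → C3} (hU : Measurable (Function.uncurry U))
    (hW : Measurable (Function.uncurry W)) : Measurable (Function.uncurry (glue a U W)) := by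
  have hS : MeasurableSet {p : ℝ × R3 | p.1 ≤ a} := measurableSet_le measurable_fst measurable_const
  have : Function.uncurry (glue a U W) =
      {p : ℝ × R3 | p.1 ≤ a}.piecewise (Function.uncurry U) (Function.uncurry W) := by
    ext1 p
    by_cases h : p.1 ≤ a
    · simp [Function.uncurry, glue, Set.piecewise, h]
    · simp [Function.uncurry, glue, Set.piecewise, h]
  rw [this]
  exact hU.piecewise hS hW

theorem glue_of_le {a t : ℝ} (U W : ℝ → R3 → C3) (h : t ≤ a) : glue a U W t = U t := if_pos h

theorem glue_of_lt {a t : ℝ} (U W : ℝ → R3 → C3) (h : a < t) : glue a U W t = W t :=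
  if_neg h.not_ge

theorem exists_gt_setLIntegral_le {f : ℝ → ℝ≥0∞} {a b : ℝ} (hab : a < b)
    (hf : ∫⁻ t in Ioc a b, f t ≠ ⊤) {ε : ℝ≥0∞} (hε : ε ≠ 0) :
    ∃ c, a < c ∧ c ≤ b ∧ ∫⁻ t in Ioc a c, f t ≤ ε := by
  obtain ⟨δ, hδ, hsmall⟩ := exists_pos_setLIntegral_lt_of_measure_lt hf hε
  obtain ⟨r, hr0, hr⟩ := ENNReal.lt_iff_exists_nnreal_btwn.1 hδ
  have hr0' : (0 : ℝ) < r := by simpa using hr0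
  refine ⟨min b (a + r), lt_min hab (by linarith), min_le_left _ _, ?_⟩
  have hsub : Ioc a (min b (a + r)) ⊆ Ioc a b := Ioc_subset_Ioc_right (min_le_left _ _)
  have := hsmall (Ioc a (min b (a + r))) (by
    refine (Measure.restrict_apply_le _ _).trans_lt ?_
    rw [Real.volume_Ioc]
    refine lt_of_le_of_lt (ENNReal.ofReal_le_ofReal (q := (r : ℝ)) ?_) (by simpa using hr)
    linarith [min_le_right b (a + r)])
  rw [Measure.restrict_restrict measurableSet_Ioc, inter_eq_left.2 hsub] at this
  exact this.le

/-- Picard iterates continuing the curve `U` beyond the time `a`. -/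
def picard (ν : ℝ) (U₀ : R3 → C3) (a : ℝ) (U : ℝ → R3 → C3) : ℕ → ℝ → R3 → C3
  | 0 => glue a U fun _ _ => 0
  | n + 1 => glue a U (mild ν U₀ (forcing (picard ν U₀ a U n)))

theorem measurable_picard (ν : ℝ) {U₀ : R3 → C3} (hU₀ : Measurable U₀) (a : ℝ) {U : ℝ → R3 → C3}
    (hU : Measurable (Function.uncurry U)) (n : ℕ) :
    Measurable (Function.uncurry (picard ν U₀ a U n)) := by
  induction n with
  | zero => exact measurable_glue a hU measurable_const
  | succ n ih => exact measurable_glue a hU (measurable_mild ν hU₀ (measurable_forcing ih))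

theorem picard_of_le (ν : ℝ) (U₀ : R3 → C3) {a t : ℝ} (U : ℝ → R3 → C3) (n : ℕ) (h : t ≤ a) :
    picard ν U₀ a U n t = U t := by
  cases n <;> exact glue_of_le _ _ h

section Extension

variable {ν : ℝ} {U₀ : R3 → C3} {a b : ℝ} {U : ℝ → R3 → C3}

/-- The squared norm of `L²((a,b]; χ⁰)`. -/
def sqNorm (a b : ℝ) (W : ℝ → R3 → C3) : ℝ≥0∞ := ∫⁻ t in Ioc a b, densityNorm 0 (W t) ^ 2

/-- The squared distance in `L²((a,b]; χ⁰)`. -/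
def sqDist (a b : ℝ) (V W : ℝ → R3 → C3) : ℝ≥0∞ :=
  ∫⁻ t in Ioc a b, densityNorm 0 (fun ξ => V t ξ - W t ξ) ^ 2

theorem sqDist_comm (a b : ℝ) (V W : ℝ → R3 → C3) : sqDist a b V W = sqDist a b W V := by
  simp only [sqDist]
  exact lintegral_congr fun t => by rw [densityNorm_sub_comm]

theorem sqDist_zero (a b : ℝ) (V : ℝ → R3 → C3) : sqDist a b V (fun _ _ => 0) = sqNorm a b V := by
  simp [sqDist, sqNorm]

theorem sqNorm_congr {V W : ℝ → R3 → C3} (h : ∀ t ∈ Ioc a b, V t = W t) :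
    sqNorm a b V = sqNorm a b W :=
  setLIntegral_congr_fun measurableSet_Ioc fun t ht => by simp only [h t ht]

theorem sqDist_congr {V W V' W' : ℝ → R3 → C3} (h : ∀ t ∈ Ioc a b, V t = V' t)
    (h' : ∀ t ∈ Ioc a b, W t = W' t) : sqDist a b V W = sqDist a b V' W' :=
  setLIntegral_congr_fun measurableSet_Ioc fun t ht => by simp only [h t ht, h' t ht]

theorem sqDist_triangle {V W Z : ℝ → R3 → C3} (hV : Measurable (Function.uncurry V))
    (hW : Measurable (Function.uncurry W)) :
    sqDist a b V Z ≤ 2 * sqDist a b V W + 2 * sqDist a b W Z :=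
  lintegral_sq_densityNorm_sub_le hV hW

theorem lintegral_sq_add_le {V W : ℝ → R3 → C3} (hV : Measurable (Function.uncurry V)) :
    ∫⁻ t in Ioc a b, (densityNorm 0 (V t) + densityNorm 0 (W t)) ^ 2 ≤
      2 * sqNorm a b V + 2 * sqNorm a b W := by
  refine (lintegral_mono fun t => add_sq_le_two_mul_add _ _).trans_eq ?_
  rw [lintegral_add_left (((measurable_densityNorm 0 hV).pow_const 2).const_mul 2),
    lintegral_const_mul' _ _ (by simp), lintegral_const_mul' _ _ (by simp)]
  rfl

theorem sqNorm_add {V : ℝ → R3 → C3} (ha : 0 ≤ a) (hab : a ≤ b) (h : ∀ t ≤ a, V t = U t) :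
    ∫⁻ t in Ioc 0 b, densityNorm 0 (V t) ^ 2 =
      (∫⁻ t in Ioc 0 a, densityNorm 0 (U t) ^ 2) + sqNorm a b V := by
  rw [lintegral_Ioc_add ha hab]
  congr 1
  exact setLIntegral_congr_fun measurableSet_Ioc fun t ht => by simp only [h t ht.2]

theorem sqDist_mild_le (hν : 0 < ν) (ha : 0 ≤ a) (hab : a ≤ b)
    (hUf : ∫⁻ t in Ioc 0 a, densityNorm 0 (U t) ^ 2 ≠ ⊤)
    {V W : ℝ → R3 → C3} (hV : Measurable (Function.uncurry V))
    (hW : Measurable (Function.uncurry W)) (hVU : ∀ t ≤ a, V t = U t) (hWU : ∀ t ≤ a, W t = U t)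
    (hVf : sqNorm a b V ≠ ⊤) (hWf : sqNorm a b W ≠ ⊤) :
    sqDist a b (mild ν U₀ (forcing V)) (mild ν U₀ (forcing W)) ≤
      (ENNReal.ofReal ν)⁻¹ * (2 * sqNorm a b V + 2 * sqNorm a b W) * sqDist a b V W := by
  have h := lintegral_sq_mild_sub_le hν U₀ hV hW ha hab
    (by rw [sqNorm_add ha hab hVU]; exact ENNReal.add_ne_top.2 ⟨hUf, hVf⟩)
    (by rw [sqNorm_add ha hab hWU]; exact ENNReal.add_ne_top.2 ⟨hUf, hWf⟩)
    ((ae_restrict_mem measurableSet_Ioc).mono fun t ht => by rw [hVU t ht.2, hWU t ht.2])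
  refine h.trans ?_
  rw [mul_assoc]
  exact mul_le_mul_right (mul_le_mul_left (lintegral_sq_add_le hV) _) _

theorem sqDist_mild_le_of_small (hν : 0 < ν) (ha : 0 ≤ a) (hab : a ≤ b)
    (hUf : ∫⁻ t in Ioc 0 a, densityNorm 0 (U t) ^ 2 ≠ ⊤)
    {V W : ℝ → R3 → C3} (hV : Measurable (Function.uncurry V))
    (hW : Measurable (Function.uncurry W)) (hVU : ∀ t ≤ a, V t = U t) (hWU : ∀ t ≤ a, W t = U t)
    (hVf : sqNorm a b V ≤ ENNReal.ofReal (ν / 16)) (hWf : sqNorm a b W ≤ ENNReal.ofReal (ν / 16)) :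
    sqDist a b (mild ν U₀ (forcing V)) (mild ν U₀ (forcing W)) ≤ 4⁻¹ * sqDist a b V W := by
  refine (sqDist_mild_le hν ha hab hUf hV hW hVU hWU
    (ne_top_of_le_ne_top ENNReal.ofReal_ne_top hVf)
    (ne_top_of_le_ne_top ENNReal.ofReal_ne_top hWf)).trans (mul_le_mul_left ?_ _)
  calc (ENNReal.ofReal ν)⁻¹ * (2 * sqNorm a b V + 2 * sqNorm a b W) ≤
      (ENNReal.ofReal ν)⁻¹ * (2 * ENNReal.ofReal (ν / 16) + 2 * ENNReal.ofReal (ν / 16)) := by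
        gcongr
    _ = 4⁻¹ := by
        rw [← ENNReal.ofReal_inv_of_pos hν, show (2 : ℝ≥0∞) = ENNReal.ofReal 2 by simp,
          show (4⁻¹ : ℝ≥0∞) = ENNReal.ofReal 4⁻¹ by
            rw [ENNReal.ofReal_inv_of_pos (by norm_num)]; simp,
          ← ENNReal.ofReal_mul (by norm_num), ← ENNReal.ofReal_add (by positivity) (by positivity),
          ← ENNReal.ofReal_mul (by positivity)]
        congr 1
        field_simp
        norm_num

theorem sqNorm_picard_le (hν : 0 < ν) (hU₀ : Measurable U₀) (ha : 0 ≤ a) (hab : a ≤ b)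
    (hU : Measurable (Function.uncurry U))
    (hUf : ∫⁻ t in Ioc 0 a, densityNorm 0 (U t) ^ 2 ≠ ⊤)
    (hA : sqNorm a b (mild ν U₀ (forcing (picard ν U₀ a U 0))) ≤ 4⁻¹ * ENNReal.ofReal (ν / 16))
    (n : ℕ) : sqNorm a b (picard ν U₀ a U n) ≤ ENNReal.ofReal (ν / 16) := by
  have hm := measurable_picard ν hU₀ a hU
  have h0 : ∀ t ∈ Ioc a b, picard ν U₀ a U 0 t = fun _ => 0 := fun t ht => glue_of_lt _ _ ht.1
  have h0' : sqNorm a b (picard ν U₀ a U 0) = 0 := by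
    rw [sqNorm_congr (W := fun _ _ => 0) h0]
    simp [sqNorm, densityNorm]
  induction n with
  | zero => rw [h0']; exact zero_le
  | succ n ih =>
    have hM := fun n => measurable_mild ν hU₀ (measurable_forcing (hm n))
    have e : sqNorm a b (picard ν U₀ a U (n + 1)) =
        sqNorm a b (mild ν U₀ (forcing (picard ν U₀ a U n))) :=
      sqNorm_congr fun t ht => glue_of_lt _ _ ht.1
    rw [e, ← sqDist_zero]
    refine (sqDist_triangle (hM n) (hM 0)).trans ?_
    have h1 := sqDist_mild_le_of_small (U₀ := U₀) hν ha hab hUf (hm n) (hm 0)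
      (fun t ht => picard_of_le ν U₀ U n ht) (fun t ht => picard_of_le ν U₀ U 0 ht) ih
      (by rw [h0']; exact zero_le)
    have h2 : sqDist a b (picard ν U₀ a U n) (picard ν U₀ a U 0) =
        sqNorm a b (picard ν U₀ a U n) := by
      rw [← sqDist_zero]
      exact sqDist_congr (fun _ _ => rfl) h0
    rw [h2] at h1
    rw [sqDist_zero]
    calc _ ≤ 2 * (4⁻¹ * ENNReal.ofReal (ν / 16)) + 2 * (4⁻¹ * ENNReal.ofReal (ν / 16)) := by
          gcongr
          exact h1.trans (by gcongr)
      _ = (4 * 4⁻¹) * ENNReal.ofReal (ν / 16) := by ring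
      _ = ENNReal.ofReal (ν / 16) := by
          rw [ENNReal.mul_inv_cancel (by simp) (by simp), one_mul]

theorem sqDist_picard_le (hν : 0 < ν) (hU₀ : Measurable U₀) (ha : 0 ≤ a) (hab : a ≤ b)
    (hU : Measurable (Function.uncurry U))
    (hUf : ∫⁻ t in Ioc 0 a, densityNorm 0 (U t) ^ 2 ≠ ⊤)
    (hA : sqNorm a b (mild ν U₀ (forcing (picard ν U₀ a U 0))) ≤ 4⁻¹ * ENNReal.ofReal (ν / 16))
    (n : ℕ) : sqDist a b (picard ν U₀ a U n) (picard ν U₀ a U (n + 1)) ≤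
      ENNReal.ofReal (ν / 16) * 4⁻¹ ^ n := by
  have hm := measurable_picard ν hU₀ a hU
  have hb := sqNorm_picard_le hν hU₀ ha hab hU hUf hA
  induction n with
  | zero =>
    have h0 : ∀ t ∈ Ioc a b, picard ν U₀ a U 0 t = fun _ => 0 := fun t ht => glue_of_lt _ _ ht.1
    rw [sqDist_comm, sqDist_congr (W' := fun _ _ => 0) (fun _ _ => rfl) h0, sqDist_zero, pow_zero,
      mul_one]
    exact hb 1
  | succ n ih =>
    have e : sqDist a b (picard ν U₀ a U (n + 1)) (picard ν U₀ a U (n + 1 + 1)) =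
        sqDist a b (mild ν U₀ (forcing (picard ν U₀ a U n)))
          (mild ν U₀ (forcing (picard ν U₀ a U (n + 1)))) :=
      sqDist_congr (fun t ht => glue_of_lt _ _ ht.1) (fun t ht => glue_of_lt _ _ ht.1)
    rw [e]
    refine (sqDist_mild_le_of_small hν ha hab hUf (hm n) (hm (n + 1))
      (fun t ht => picard_of_le ν U₀ U _ ht) (fun t ht => picard_of_le ν U₀ U _ ht)
      (hb n) (hb (n + 1))).trans ?_
    calc _ ≤ 4⁻¹ * (ENNReal.ofReal (ν / 16) * 4⁻¹ ^ n) := mul_le_mul_right ih _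
      _ = _ := by ring

theorem eq_zero_of_forall_le_geometric {x C : ℝ≥0∞} (hC : C ≠ ⊤) (h : ∀ n : ℕ, x ≤ C * 4⁻¹ ^ n) :
    x = 0 := by
  have h1 : Tendsto (fun n : ℕ => C * (4⁻¹ : ℝ≥0∞) ^ n) atTop (𝓝 (C * 0)) :=
    ENNReal.Tendsto.const_mul (ENNReal.tendsto_pow_atTop_nhds_zero_of_lt_one (by
      rw [ENNReal.inv_lt_one]; norm_num)) (Or.inr hC)
  rw [mul_zero] at h1
  exact le_antisymm (ge_of_tendsto' h1 h) zero_le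

theorem FourierSolution.exists_extension (hν : 0 < ν) (hU₀ : Measurable U₀)
    (h₀ : densityNorm (-1) U₀ ≠ ⊤) (ha : 0 ≤ a) (hU : FourierSolution ν U₀ a U) :
    ∃ b, a < b ∧ ∃ V, FourierSolution ν U₀ b V := by
  have hm := measurable_picard ν hU₀ a hU.meas
  have hM := fun n => measurable_mild ν hU₀ (measurable_forcing (hm n))
  have hν16 : ENNReal.ofReal (ν / 16) ≠ 0 := (ENNReal.ofReal_pos.2 (by positivity)).ne'
  have hUf := hU.sq_ne_top
  obtain ⟨b, hab, -, hA⟩ : ∃ b, a < b ∧ b ≤ a + 1 ∧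
      sqNorm a b (mild ν U₀ (forcing (picard ν U₀ a U 0))) ≤ 4⁻¹ * ENNReal.ofReal (ν / 16) := by
    refine exists_gt_setLIntegral_le (by linarith) ?_ (mul_ne_zero (by simp) hν16)
    refine ne_top_of_le_ne_top ?_ (lintegral_mono_set (Ioc_subset_Ioc_left ha))
    have h1 := lintegral_sq_mild_le hν hU₀ (measurable_forcing (hm 0)) (T := a + 1) (by linarith)
    have h2 : ∫⁻ s in Ioc 0 (a + 1), densityNorm (-1) (forcing (picard ν U₀ a U 0) s) ≠ ⊤ := by
      refine ne_top_of_le_ne_top ?_ (lintegral_forcing_le (hm 0) _)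
      rw [sqNorm_add ha (by linarith : a ≤ a + 1) fun t ht => picard_of_le ν U₀ U 0 ht,
        sqNorm_congr (W := fun _ _ => 0) fun t ht => glue_of_lt _ _ ht.1]
      simpa [sqNorm, densityNorm] using hUf
    intro htop
    rw [htop, ENNReal.mul_top (ENNReal.ofReal_pos.2 hν).ne', top_le_iff] at h1
    exact ENNReal.pow_ne_top (ENNReal.add_ne_top.2 ⟨h₀, h2⟩) h1
  have hb := sqNorm_picard_le hν hU₀ ha hab.le hU.meas hUf hA
  obtain ⟨W', hW'm, hW'⟩ := exists_limit_of_geometric hm ENNReal.ofReal_ne_top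
    (sqDist_picard_le hν hU₀ ha hab.le hU.meas hUf hA)
  set W := glue a U W' with hWdef
  have hWm : Measurable (Function.uncurry W) := measurable_glue a hU.meas hW'm
  have hWU : ∀ t ≤ a, W t = U t := fun t ht => glue_of_le _ _ ht
  have hlim : ∀ n, sqDist a b (picard ν U₀ a U n) W ≤
      4 * (ENNReal.ofReal (ν / 16) * 4⁻¹ ^ n) := by
    intro n
    rw [sqDist_congr (W' := W') (fun _ _ => rfl) fun t ht => glue_of_lt _ _ ht.1]
    exact hW' n
  have hWf : sqNorm a b W ≠ ⊤ := by
    rw [← sqDist_zero]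
    refine ne_top_of_le_ne_top ?_ (sqDist_triangle hWm (hm 0))
    rw [sqDist_comm, sqDist_zero]
    refine ENNReal.add_ne_top.2 ⟨ENNReal.mul_ne_top (by simp) ?_, ENNReal.mul_ne_top (by simp) ?_⟩
    · exact ne_top_of_le_ne_top (ENNReal.mul_ne_top (by simp)
        (ENNReal.mul_ne_top ENNReal.ofReal_ne_top (by simp))) (hlim 0)
    · exact ne_top_of_le_ne_top ENNReal.ofReal_ne_top (hb 0)
  have hMW := measurable_mild ν hU₀ (measurable_forcing hWm)
  set G := (ENNReal.ofReal ν)⁻¹ * (2 * ENNReal.ofReal (ν / 16) + 2 * sqNorm a b W) with hG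
  have hGtop : G ≠ ⊤ := ENNReal.mul_ne_top (ENNReal.inv_ne_top.2 (ENNReal.ofReal_pos.2 hν).ne')
    (ENNReal.add_ne_top.2 ⟨ENNReal.mul_ne_top (by simp) ENNReal.ofReal_ne_top,
      ENNReal.mul_ne_top (by simp) hWf⟩)
  have hzero : sqDist a b W (mild ν U₀ (forcing W)) = 0 := by
    refine eq_zero_of_forall_le_geometric
      (C := (2 + 2 * G) * (4 * ENNReal.ofReal (ν / 16))) ?_ fun n => ?_
    · exact ENNReal.mul_ne_top (ENNReal.add_ne_top.2 ⟨by simp, ENNReal.mul_ne_top (by simp) hGtop⟩)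
        (ENNReal.mul_ne_top (by simp) ENNReal.ofReal_ne_top)
    refine (sqDist_triangle hWm (hm (n + 1))).trans ?_
    have h1 : sqDist a b W (picard ν U₀ a U (n + 1)) ≤
        4 * (ENNReal.ofReal (ν / 16) * 4⁻¹ ^ n) := by
      rw [sqDist_comm]
      refine (hlim (n + 1)).trans ?_
      gcongr 4 * (_ * ?_)
      exact pow_le_pow_right_of_le_one' (by simp) (Nat.le_succ n)
    have h2 : sqDist a b (picard ν U₀ a U (n + 1)) (mild ν U₀ (forcing W)) ≤
        G * (4 * (ENNReal.ofReal (ν / 16) * 4⁻¹ ^ n)) := by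
      rw [sqDist_congr (V := picard ν U₀ a U (n + 1))
        (V' := mild ν U₀ (forcing (picard ν U₀ a U n)))
        (fun t ht => glue_of_lt _ _ ht.1) fun _ _ => rfl]
      refine (sqDist_mild_le hν ha hab.le hUf (hm n) hWm
        (fun t ht => picard_of_le ν U₀ U n ht) hWU
        (ne_top_of_le_ne_top ENNReal.ofReal_ne_top (hb n)) hWf).trans ?_
      rw [hG]
      gcongr
      · exact hb n
      · exact hlim n
    calc _ ≤ 2 * (4 * (ENNReal.ofReal (ν / 16) * 4⁻¹ ^ n)) +
          2 * (G * (4 * (ENNReal.ofReal (ν / 16) * 4⁻¹ ^ n))) := by gcongr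
      _ = _ := by ring
  refine ⟨b, hab, W, hWm, ?_, ?_⟩
  · rw [sqNorm_add ha hab.le hWU]
    exact ENNReal.add_ne_top.2 ⟨hUf, hWf⟩
  · rw [← Ioc_union_Ioc_eq_Ioc ha hab.le, ae_restrict_union_iff]
    constructor
    · have hF : ∀ᵐ s ∂(volume.restrict (Ioc 0 a)), forcing W s = forcing U s :=
        (ae_restrict_mem measurableSet_Ioc).mono fun s hs => by rw [forcing, forcing, hWU s hs.2]
      filter_upwards [hU.eq_mild, ae_restrict_mem measurableSet_Ioc] with t h1 h2
      rw [hWU t h2.2, mild_congr ν U₀ hF h2.1.le h2.2]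
      exact h1
    · have hmd : Measurable fun t => densityNorm 0 (fun ξ => W t ξ - mild ν U₀ (forcing W) t ξ) :=
        measurable_densityNorm (F := fun t ξ => W t ξ - mild ν U₀ (forcing W) t ξ) 0 (hWm.sub hMW)
      rw [sqDist, lintegral_eq_zero_iff (hmd.pow_const 2)] at hzero
      filter_upwards [hzero] with t ht
      exact ae_eq_of_densityNorm_zero hWm.of_uncurry_left hMW.of_uncurry_left (by simpa using ht)

end Extension

/-- The maximal time of existence, on the Fourier side. -/
def fourierMaxTime (ν : ℝ) (U₀ : R3 → C3) : ℝ≥0∞ :=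
  ⨆ (T : ℝ) (_ : 0 < T ∧ ∃ U, FourierSolution ν U₀ T U), ENNReal.ofReal T

theorem densityNorm_le_sub_add {V W : R3 → C3} (hV : Measurable V) (hW : Measurable W) (r : ℤ) :
    densityNorm r V ≤ densityNorm r (fun ξ => V ξ - W ξ) + densityNorm r W := by
  have hm : Measurable fun ξ => ‖V ξ - W ξ‖ₑ := (hV.sub hW).enorm
  simp only [densityNorm]
  rw [← lintegral_add_left (measurable_weight_mul r hm)]
  refine lintegral_mono fun ξ => ?_
  rw [← mul_add]
  refine mul_le_mul_right ?_ _
  calc ‖V ξ‖ₑ = ‖(V ξ - W ξ) + W ξ‖ₑ := by rw [sub_add_cancel]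
    _ ≤ _ := enorm_add_le _ _

section Maximal

variable {ν : ℝ} {U₀ : R3 → C3}

theorem fourierSolution_zero (ν : ℝ) (U₀ : R3 → C3) : FourierSolution ν U₀ 0 fun _ _ => 0 where
  meas := measurable_const
  sq_ne_top := by simp
  eq_mild := by simp

theorem FourierSolution.lt_fourierMaxTime (hν : 0 < ν) (hU₀ : Measurable U₀)
    (h₀ : densityNorm (-1) U₀ ≠ ⊤) {T : ℝ} (hT : 0 ≤ T) {U : ℝ → R3 → C3}
    (hU : FourierSolution ν U₀ T U) : ENNReal.ofReal T < fourierMaxTime ν U₀ := by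
  obtain ⟨b, hb, V, hV⟩ := hU.exists_extension hν hU₀ h₀ hT
  have hb0 : 0 < b := hT.trans_lt hb
  exact ((ENNReal.ofReal_lt_ofReal_iff hb0).2 hb).trans_le
    (le_iSup₂ (f := fun (T : ℝ) (_ : 0 < T ∧ ∃ U, FourierSolution ν U₀ T U) => ENNReal.ofReal T)
      b ⟨hb0, V, hV⟩)

theorem fourierMaxTime_pos (hν : 0 < ν) (hU₀ : Measurable U₀)
    (h₀ : densityNorm (-1) U₀ ≠ ⊤) : 0 < fourierMaxTime ν U₀ := by
  simpa using (fourierSolution_zero ν U₀).lt_fourierMaxTime hν hU₀ h₀ le_rfl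

theorem exists_glued_solution (hν : 0 < ν) (hU₀ : Measurable U₀) (h₀ : densityNorm (-1) U₀ ≠ ⊤) :
    ∃ U : ℝ → R3 → C3, Measurable (Function.uncurry U) ∧
      ∀ T, 0 < T → ENNReal.ofReal T < fourierMaxTime ν U₀ → FourierSolution ν U₀ T U := by
  set S : Set ℝ≥0∞ := {x | ∃ T : ℝ, (0 < T ∧ ∃ U, FourierSolution ν U₀ T U) ∧
    x = ENNReal.ofReal T} with hS
  have hsup : sSup S = fourierMaxTime ν U₀ := by
    refine le_antisymm (sSup_le ?_) (iSup₂_le fun T hT => le_sSup ⟨T, hT, rfl⟩)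
    rintro x ⟨T, hT, rfl⟩
    exact le_iSup₂
      (f := fun (T : ℝ) (_ : 0 < T ∧ ∃ U, FourierSolution ν U₀ T U) => ENNReal.ofReal T) T hT
  have hne : S.Nonempty := by
    obtain ⟨b, hb, V, hV⟩ := (fourierSolution_zero ν U₀).exists_extension hν hU₀ h₀ le_rfl
    exact ⟨_, b, ⟨hb, V, hV⟩, rfl⟩
  obtain ⟨x, -, hx, hxS⟩ := exists_seq_tendsto_sSup hne (OrderTop.bddAbove S)
  choose τ hτ hxτ using hxS
  choose hτ0 V hV using hτ
  set B : ℕ → Set ℝ := fun n => disjointed (fun n => Iic (τ n)) n with hB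
  have hBm : ∀ n, MeasurableSet (B n) :=
    fun n => MeasurableSet.disjointed (fun _ => measurableSet_Iic) n
  obtain ⟨f, hf, hfV⟩ := exists_measurable_piecewise (fun n => (Prod.fst ⁻¹' B n : Set (ℝ × R3)))
    (fun n => measurable_fst (hBm n)) (fun n => Function.uncurry (V n)) (fun n => (hV n).meas) (by
      intro i j hij p hp
      have hd : Disjoint (B i) (B j) := disjoint_disjointed _ hij
      exact absurd (show p.1 ∈ B j from hp.2) (disjoint_left.1 hd (show p.1 ∈ B i from hp.1)))
  have hUV : ∀ n t, t ∈ B n → (fun ξ => f (t, ξ)) = V n t := by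
    intro n t ht
    ext1 ξ
    exact hfV n (show (t, ξ) ∈ Prod.fst ⁻¹' B n from ht)
  refine ⟨fun t ξ => f (t, ξ), hf, fun T hT hTmax => ?_⟩
  rw [← hsup] at hTmax
  obtain ⟨n, hn⟩ := (hx.eventually (lt_mem_nhds hTmax)).exists
  rw [hxτ n, ENNReal.ofReal_lt_ofReal_iff (hτ0 n)] at hn
  have hTn := (hV n).mono hn.le
  refine hTn.congr hf ?_
  have hpair : ∀ m, ∀ᵐ t ∂(volume.restrict (Ioc 0 T)), t ≤ τ m → V n t =ᵐ[volume] V m t := by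
    intro m
    have h1 := FourierSolution.ae_eq hν (le_min hT.le (hτ0 m).le) (hTn.mono (min_le_left T (τ m)))
      ((hV m).mono (min_le_right T (τ m)))
    rw [ae_restrict_iff' measurableSet_Ioc] at h1 ⊢
    filter_upwards [h1] with t ht ht1 ht2
    exact ht ⟨ht1.1, le_min ht1.2 ht2⟩
  filter_upwards [ae_all_iff.2 hpair, ae_restrict_mem measurableSet_Ioc] with t ht htT
  have hmem : t ∈ ⋃ n, B n := by
    rw [hB, iUnion_disjointed]
    exact mem_iUnion.2 ⟨n, htT.2.trans hn.le⟩
  obtain ⟨m, hm⟩ := mem_iUnion.1 hmem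
  rw [hUV m t hm]
  exact ht m (disjointed_subset _ m hm)

/-- A maximal solution which is normalized to satisfy the Duhamel formula at all times. -/
structure MaximalSolution (ν : ℝ) (U₀ : R3 → C3) (V : ℝ → R3 → C3) : Prop where
  pos : 0 < ν
  meas_data : Measurable U₀
  data_ne_top : densityNorm (-1) U₀ ≠ ⊤
  meas : Measurable (Function.uncurry V)
  initial : V 0 = U₀
  solution : ∀ T, 0 < T → ENNReal.ofReal T < fourierMaxTime ν U₀ → FourierSolution ν U₀ T V
  eq_mild : ∀ t, 0 ≤ t → ENNReal.ofReal t < fourierMaxTime ν U₀ → V t = mild ν U₀ (forcing V) t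

theorem exists_maximalSolution (hν : 0 < ν) (hU₀ : Measurable U₀)
    (h₀ : densityNorm (-1) U₀ ≠ ⊤) : ∃ V, MaximalSolution ν U₀ V := by
  obtain ⟨U, hUm, hU⟩ := exists_glued_solution hν hU₀ h₀
  have hM := measurable_mild ν hU₀ (measurable_forcing hUm)
  refine ⟨mild ν U₀ (forcing U), hν, hU₀, h₀, hM, mild_zero_time _ _ _,
    fun T hT hTmax => (hU T hT hTmax).congr hM (hU T hT hTmax).eq_mild, fun t ht htmax => ?_⟩
  rcases ht.eq_or_lt with rfl | ht
  · rw [mild_zero_time, mild_zero_time]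
  · exact mild_congr ν U₀ ((hU t ht htmax).eq_mild.mono fun s hs => nonlinearHat_congr hs)
      ht.le le_rfl

namespace MaximalSolution

variable {V : ℝ → R3 → C3}

theorem ae_eq (h : MaximalSolution ν U₀ V) {T : ℝ} (hT : 0 < T) {W : ℝ → R3 → C3}
    (hW : FourierSolution ν U₀ T W) :
    ∀ᵐ t ∂(volume.restrict (Ioc 0 T)), W t =ᵐ[volume] V t :=
  hW.ae_eq h.pos hT.le
    (h.solution T hT (hW.lt_fourierMaxTime h.pos h.meas_data h.data_ne_top hT.le))

theorem lintegral_forcing_ne_top (h : MaximalSolution ν U₀ V) {T : ℝ} (hT : 0 ≤ T)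
    (hTmax : ENNReal.ofReal T < fourierMaxTime ν U₀) :
    ∫⁻ s in Ioc 0 T, densityNorm (-1) (forcing V s) ≠ ⊤ := by
  rcases hT.eq_or_lt with rfl | hT
  · simp
  · exact ne_top_of_le_ne_top (h.solution T hT hTmax).sq_ne_top (lintegral_forcing_le h.meas _)

theorem lt_of_le (_ : MaximalSolution ν U₀ V) {t T : ℝ} (htT : t ≤ T)
    (hTmax : ENNReal.ofReal T < fourierMaxTime ν U₀) : ENNReal.ofReal t < fourierMaxTime ν U₀ :=
  (ENNReal.ofReal_le_ofReal htT).trans_lt hTmax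

theorem energy (h : MaximalSolution ν U₀ V) {T : ℝ} (hT : 0 ≤ T)
    (hTmax : ENNReal.ofReal T < fourierMaxTime ν U₀) :
    densityNorm (-1) (V T) + ENNReal.ofReal ν * ∫⁻ t in Ioc 0 T, densityNorm 1 (V t) ≤
      densityNorm (-1) U₀ + ∫⁻ s in Ioc 0 T, densityNorm (-1) (forcing V s) := by
  have e := mild_energy h.pos h.meas_data (measurable_forcing h.meas) hT
  rw [← h.eq_mild T hT hTmax] at e
  rwa [setLIntegral_congr_fun measurableSet_Ioc fun t ht => by
    simp only [← h.eq_mild t ht.1.le (h.lt_of_le ht.2 hTmax)]; rfl] at e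

theorem densityNorm_le (h : MaximalSolution ν U₀ V) {t T : ℝ} (ht : 0 ≤ t) (htT : t ≤ T)
    (hTmax : ENNReal.ofReal T < fourierMaxTime ν U₀) :
    densityNorm (-1) (V t) ≤
      densityNorm (-1) U₀ + ∫⁻ s in Ioc 0 T, densityNorm (-1) (forcing V s) := by
  rw [h.eq_mild t ht (h.lt_of_le htT hTmax)]
  exact densityNorm_mild_le h.pos h.meas_data (measurable_forcing h.meas) ht htT

theorem densityNorm_ne_top (h : MaximalSolution ν U₀ V) {t : ℝ} (ht : 0 ≤ t)
    (htmax : ENNReal.ofReal t < fourierMaxTime ν U₀) : densityNorm (-1) (V t) ≠ ⊤ :=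
  ne_top_of_le_ne_top
    (ENNReal.add_ne_top.2 ⟨h.data_ne_top, h.lintegral_forcing_ne_top ht htmax⟩)
    (h.densityNorm_le ht le_rfl htmax)

theorem lintegral_densityNorm_one_ne_top (h : MaximalSolution ν U₀ V) {T : ℝ} (hT : 0 ≤ T)
    (hTmax : ENNReal.ofReal T < fourierMaxTime ν U₀) :
    ∫⁻ t in Ioc 0 T, densityNorm 1 (V t) ≠ ⊤ := by
  intro htop
  have e := h.energy hT hTmax
  rw [htop, ENNReal.mul_top (ENNReal.ofReal_pos.2 h.pos).ne', add_top, top_le_iff] at e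
  exact ENNReal.add_ne_top.2 ⟨h.data_ne_top, h.lintegral_forcing_ne_top hT hTmax⟩ e

theorem tendsto_sub (h : MaximalSolution ν U₀ V) {T : ℝ}
    (hTmax : ENNReal.ofReal T < fourierMaxTime ν U₀) {t : ℝ} (ht : t ∈ Icc 0 T) :
    Tendsto (fun τ => densityNorm (-1) (fun ξ => V τ ξ - V t ξ)) (𝓝[Icc 0 T] t) (𝓝 0) := by
  have key := tendsto_densityNorm_mild_sub h.pos h.meas_data (measurable_forcing h.meas)
    h.data_ne_top (h.lintegral_forcing_ne_top (ht.1.trans ht.2) hTmax) ht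
  refine key.congr' ?_
  filter_upwards [self_mem_nhdsWithin] with τ hτ
  rw [← h.eq_mild τ hτ.1 (h.lt_of_le hτ.2 hTmax), ← h.eq_mild t ht.1 (h.lt_of_le ht.2 hTmax)]

theorem blowup (h : MaximalSolution ν U₀ V) (hmax : fourierMaxTime ν U₀ ≠ ⊤) :
    ∫⁻ t in Ioc 0 (fourierMaxTime ν U₀).toReal, densityNorm 0 (V t) ^ 2 = ⊤ := by
  by_contra hfin
  set T := (fourierMaxTime ν U₀).toReal with hT
  have hofT : ENNReal.ofReal T = fourierMaxTime ν U₀ := ENNReal.ofReal_toReal hmax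
  have hT0 : 0 < T := ENNReal.toReal_pos
    (fourierMaxTime_pos h.pos h.meas_data h.data_ne_top).ne' hmax
  have hsol : FourierSolution ν U₀ T V := by
    refine ⟨h.meas, hfin, ?_⟩
    rw [← restrict_Ioo_eq_restrict_Ioc]
    filter_upwards [ae_restrict_mem measurableSet_Ioo] with t ht
    have : ENNReal.ofReal t < fourierMaxTime ν U₀ := by
      rw [← hofT]
      exact (ENNReal.ofReal_lt_ofReal_iff hT0).2 ht.2
    rw [← h.eq_mild t ht.1.le this]
  have := hsol.lt_fourierMaxTime h.pos h.meas_data h.data_ne_top hT0.le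
  rw [hofT] at this
  exact lt_irrefl _ this

theorem energy_of_le (h : MaximalSolution ν U₀ V) {T : ℝ} (hT : 0 ≤ T)
    (hTmax : ENNReal.ofReal T < fourierMaxTime ν U₀) {M : ℝ≥0∞}
    (hM : ∀ t ∈ Ioo 0 T, densityNorm (-1) (V t) ≤ M) :
    densityNorm (-1) (V T) + ENNReal.ofReal ν * ∫⁻ t in Ioc 0 T, densityNorm 1 (V t) ≤
      densityNorm (-1) U₀ + M * ∫⁻ t in Ioc 0 T, densityNorm 1 (V t) := by
  refine (h.energy hT hTmax).trans (add_le_add le_rfl ?_)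
  refine (lintegral_forcing_le h.meas _).trans ?_
  rw [← lintegral_const_mul _ (measurable_densityNorm 1 h.meas), ← restrict_Ioo_eq_restrict_Ioc]
  refine setLIntegral_mono' measurableSet_Ioo fun t ht => ?_
  exact (sq_densityNorm_zero_le h.meas.of_uncurry_left).trans (mul_le_mul_left (hM t ht) _)

theorem densityNorm_le_data (h : MaximalSolution ν U₀ V)
    (hsmall : densityNorm (-1) U₀ < ENNReal.ofReal ν) {T : ℝ}
    (hTmax : ENNReal.ofReal T < fourierMaxTime ν U₀) {t : ℝ} (ht : t ∈ Icc 0 T) :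
    densityNorm (-1) (V t) ≤ densityNorm (-1) U₀ := by
  set M := densityNorm (-1) U₀ with hMdef
  have hVt : ∀ t, Measurable (V t) := fun t => h.meas.of_uncurry_left
  set s : Set ℝ := {t | ∀ r ∈ Icc 0 t, densityNorm (-1) (V r) ≤ M} with hs
  have hup : ∀ t ∈ Icc 0 T, (∀ r ∈ Ico 0 t, densityNorm (-1) (V r) ≤ M) →
      densityNorm (-1) (V t) ≤ M := by
    intro t ht hr
    have e := h.energy_of_le ht.1 (h.lt_of_le ht.2 hTmax) (M := M) fun r hr' =>
      hr r ⟨hr'.1.le, hr'.2⟩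
    have hfin := h.lintegral_densityNorm_one_ne_top ht.1 (h.lt_of_le ht.2 hTmax)
    have e2 : densityNorm (-1) (V t) + M * (∫⁻ t in Ioc 0 t, densityNorm 1 (V t)) ≤
        M + M * ∫⁻ t in Ioc 0 t, densityNorm 1 (V t) :=
      (add_le_add le_rfl (mul_le_mul_left hsmall.le _)).trans e
    exact (ENNReal.add_le_add_iff_right (ENNReal.mul_ne_top h.data_ne_top hfin)).1 e2
  have hmain : Icc 0 T ⊆ s := by
    refine IsClosed.Icc_subset_of_forall_exists_gt ?_ ?_ ?_
    · refine isClosed_of_closure_subset fun t ht => ?_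
      have htI : t ∈ Icc 0 T := isClosed_Icc.closure_subset_iff.2 inter_subset_right ht
      refine ⟨fun r hr => ?_, htI⟩
      have hlt : ∀ r ∈ Ico 0 t, densityNorm (-1) (V r) ≤ M := by
        intro r hr
        obtain ⟨y, hy1, hy2⟩ := mem_closure_iff.1 ht (Ioi r) isOpen_Ioi hr.2
        exact hy2.1 r ⟨hr.1, le_of_lt hy1⟩
      rcases hr.2.eq_or_lt with rfl | h'
      · exact hup r htI hlt
      · exact hlt r ⟨hr.1, h'⟩
    · intro r hr
      have : r = 0 := le_antisymm hr.2 hr.1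
      rw [this, h.initial]
    · rintro x ⟨hxs, hx⟩ y hy
      obtain ⟨ν', hν1, hν2⟩ := exists_between hsmall
      have hM0 : M ≠ ⊤ := h.data_ne_top
      have hcont := h.tendsto_sub hTmax (t := x) ⟨hx.1, hx.2.le⟩
      have hev : ∀ᶠ τ in 𝓝[Icc 0 T] x,
          densityNorm (-1) (fun ξ => V τ ξ - V x ξ) < ν' - M :=
        hcont.eventually (gt_mem_nhds (tsub_pos_of_lt hν1))
      rw [nhdsWithin, eventually_inf_principal, Metric.eventually_nhds_iff] at hev
      obtain ⟨ε, hε, hev⟩ := hev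
      set z := min (min y T) (x + ε / 2) with hz
      have hxz : x < z := lt_min (lt_min hy hx.2) (by linarith)
      have hzT : z ≤ T := (min_le_left _ _).trans (min_le_right _ _)
      have hzy : z ≤ y := (min_le_left _ _).trans (min_le_left _ _)
      have hzε : z ≤ x + ε / 2 := min_le_right _ _
      have hbd : ∀ r ∈ Icc 0 z, densityNorm (-1) (V r) ≤ ν' := by
        intro r hr
        rcases le_total r x with hrx | hrx
        · exact (hxs r ⟨hr.1, hrx⟩).trans hν1.le
        · have h1 := hev (y := r) (by
            rw [Real.dist_eq, abs_of_nonneg (by linarith)]; linarith [hr.2]) ⟨hr.1, hr.2.trans hzT⟩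
          refine (densityNorm_le_sub_add (hVt r) (hVt x) (-1)).trans ?_
          refine (add_le_add h1.le (hxs x ⟨hx.1, le_rfl⟩)).trans_eq ?_
          exact tsub_add_cancel_of_le hν1.le
      refine ⟨z, fun r hr => ?_, hxz, hzy⟩
      have hrmax := h.lt_of_le (hr.2.trans hzT) hTmax
      have e := h.energy_of_le hr.1 hrmax (M := ν') fun q hq =>
        hbd q ⟨hq.1.le, hq.2.le.trans hr.2⟩
      have hfin := h.lintegral_densityNorm_one_ne_top hr.1 hrmax
      have e2 : densityNorm (-1) (V r) + ν' * (∫⁻ t in Ioc 0 r, densityNorm 1 (V t)) ≤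
          M + ν' * ∫⁻ t in Ioc 0 r, densityNorm 1 (V t) :=
        (add_le_add le_rfl (mul_le_mul_left hν2.le _)).trans e
      exact (ENNReal.add_le_add_iff_right
        (ENNReal.mul_ne_top (ne_top_of_lt hν2) hfin)).1 e2
  exact hmain ht t ⟨ht.1, le_rfl⟩

theorem small_data_energy (h : MaximalSolution ν U₀ V)
    (hsmall : densityNorm (-1) U₀ < ENNReal.ofReal ν) {T : ℝ} (hT : 0 ≤ T)
    (hTmax : ENNReal.ofReal T < fourierMaxTime ν U₀) :
    densityNorm (-1) (V T) +
      (ENNReal.ofReal ν - densityNorm (-1) U₀) * ∫⁻ t in Ioc 0 T, densityNorm 1 (V t) ≤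
      densityNorm (-1) U₀ := by
  have e := h.energy_of_le hT hTmax fun t ht =>
    h.densityNorm_le_data hsmall hTmax ⟨ht.1.le, ht.2.le⟩
  have hfin := h.lintegral_densityNorm_one_ne_top hT hTmax
  refine (ENNReal.add_le_add_iff_right (ENNReal.mul_ne_top h.data_ne_top hfin)).1 ?_
  rwa [add_assoc, ← add_mul, tsub_add_cancel_of_le hsmall.le]

theorem small_data_global (h : MaximalSolution ν U₀ V)
    (hsmall : densityNorm (-1) U₀ < ENNReal.ofReal ν) : fourierMaxTime ν U₀ = ⊤ := by
  by_contra hmax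
  set T := (fourierMaxTime ν U₀).toReal with hT
  set M := densityNorm (-1) U₀ with hM
  have hofT : ENNReal.ofReal T = fourierMaxTime ν U₀ := ENNReal.ofReal_toReal hmax
  have hT0 : 0 < T := ENNReal.toReal_pos
    (fourierMaxTime_pos h.pos h.meas_data h.data_ne_top).ne' hmax
  have hlt : ∀ t < T, ENNReal.ofReal t < fourierMaxTime ν U₀ := fun t ht => by
    rw [← hofT]; exact (ENNReal.ofReal_lt_ofReal_iff hT0).2 ht
  have hδ : ENNReal.ofReal ν - M ≠ 0 := (tsub_pos_of_lt hsmall).ne'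
  have hδt : ENNReal.ofReal ν - M ≠ ⊤ := ENNReal.sub_ne_top ENNReal.ofReal_ne_top
  have hbound : ∀ t ∈ Ico 0 T, ∫⁻ r in Ioc 0 t, densityNorm 1 (V r) ≤
      M / (ENNReal.ofReal ν - M) := by
    intro t ht
    rw [ENNReal.le_div_iff_mul_le (Or.inl hδ) (Or.inl hδt), mul_comm]
    exact le_add_self.trans (h.small_data_energy hsmall ht.1 (hlt t ht.2))
  obtain ⟨x, hxmono, hxlt, hx⟩ := exists_seq_strictMono_tendsto T
  have hU : Ioo 0 T = ⋃ n, Ioc 0 (x n) := by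
    ext t
    simp only [mem_Ioo, mem_iUnion, mem_Ioc]
    constructor
    · rintro ⟨h1, h2⟩
      obtain ⟨n, hn⟩ := (hx.eventually (lt_mem_nhds h2)).exists
      exact ⟨n, h1, hn.le⟩
    · rintro ⟨n, h1, h2⟩
      exact ⟨h1, h2.trans_lt (hxlt n)⟩
  have hint : ∫⁻ r in Ioc 0 T, densityNorm 1 (V r) ≤ M / (ENNReal.ofReal ν - M) := by
    rw [← restrict_Ioo_eq_restrict_Ioc, hU, setLIntegral_iUnion_of_directed]
    · refine iSup_le fun n => ?_
      rcases le_total (x n) 0 with hn | hn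
      · rw [Ioc_eq_empty (not_lt.2 hn)]; simp
      · exact hbound _ ⟨hn, hxlt n⟩
    · exact directed_of_isDirected_le fun i j hij => Ioc_subset_Ioc_right (hxmono.monotone hij)
  have hb := h.blowup hmax
  rw [← hT] at hb
  have : ∫⁻ t in Ioc 0 T, densityNorm 0 (V t) ^ 2 ≤ M * (M / (ENNReal.ofReal ν - M)) := by
    refine le_trans ?_ (mul_le_mul_right hint M)
    rw [← lintegral_const_mul _ (measurable_densityNorm 1 h.meas), ← restrict_Ioo_eq_restrict_Ioc]
    refine setLIntegral_mono' measurableSet_Ioo fun t ht => ?_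
    refine (sq_densityNorm_zero_le h.meas.of_uncurry_left).trans (mul_le_mul_left ?_ _)
    exact h.densityNorm_le_data hsmall (hlt t ht.2) ⟨ht.1.le, le_rfl⟩
  rw [hb, top_le_iff] at this
  exact ENNReal.mul_ne_top h.data_ne_top (ENNReal.div_ne_top h.data_ne_top hδ) this

end MaximalSolution

end Maximal

theorem sum_mul_mild {ν : ℝ} {U₀ : R3 → C3} {F : ℝ → R3 → C3} {ξ : R3} {t : ℝ} (ht : 0 ≤ t)
    (hi : IntegrableOn (fun s => F s ξ) (Ioc 0 t)) (h0 : ∑ j, (ξ j : ℂ) * U₀ ξ j = 0)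
    (hF : ∀ s, ∑ j, (ξ j : ℂ) * F s ξ j = 0) : ∑ j, (ξ j : ℂ) * mild ν U₀ F t ξ j = 0 := by
  simp only [← inner_complexify] at *
  have hc := (innerSL ℂ (complexify ξ)).intervalIntegral_comp_comm
    (intervalIntegrable_heat_smul ν t hi ht le_rfl)
  simp only [innerSL_apply_apply] at hc
  rw [mild, inner_add_right, ← hc]
  simp [inner_smul_right_eq_smul, h0, hF]

theorem MaximalSolution.sum_mul {ν : ℝ} {U₀ : R3 → C3} {V : ℝ → R3 → C3}
    (h : MaximalSolution ν U₀ V) (h0 : ∀ᵐ ξ, ∑ j, (ξ j : ℂ) * U₀ ξ j = 0) {t : ℝ} (ht : 0 ≤ t)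
    (htmax : ENNReal.ofReal t < fourierMaxTime ν U₀) :
    ∀ᵐ ξ, ∑ j, (ξ j : ℂ) * V t ξ j = 0 := by
  rw [h.eq_mild t ht htmax]
  have hne : ∀ᵐ ξ : R3, ξ ≠ 0 := by simp [ae_iff]
  filter_upwards [h0, hne, ae_integrableOn_of_densityNorm (measurable_forcing h.meas)
    (h.lintegral_forcing_ne_top ht htmax)] with ξ h1 h2 h3
  exact sum_mul_mild ht h3 h1 fun s => sum_mul_nonlinearHat (V s) h2

/-- Componentwise complex conjugation on `ℂ³`. -/
def conjC3 : C3 ≃ₗᵢ[ℝ] C3 := LinearIsometryEquiv.piLpCongrRight 2 fun _ => Complex.conjLIE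

theorem conjReflect_eq (g : R3 → C3) (ξ : R3) : conjReflect g ξ = conjC3 (g (-ξ)) := by
  ext j
  simp [conjReflect, conjC3]

theorem densityNorm_conjReflect (r : ℤ) (g : R3 → C3) :
    densityNorm r (conjReflect g) = densityNorm r g := by
  simp only [densityNorm]
  rw [← lintegral_neg_eq_self]
  simp only [norm_neg]
  refine lintegral_congr fun ξ => ?_
  rw [conjReflect_eq, neg_neg, ← ofReal_norm, LinearIsometryEquiv.norm_map, ofReal_norm]

theorem conjReflect_congr {g h : R3 → C3} (H : g =ᵐ[volume] h) :
    conjReflect g =ᵐ[volume] conjReflect h := by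
  have : (fun ξ => g (-ξ)) =ᵐ[volume] fun ξ => h (-ξ) :=
    (Measure.measurePreserving_neg volume).quasiMeasurePreserving.ae_eq H
  filter_upwards [this] with ξ hξ
  rw [conjReflect_eq, conjReflect_eq, hξ]

theorem conjReflect_mild (ν : ℝ) (U₀ : R3 → C3) (F : ℝ → R3 → C3) (t : ℝ) :
    conjReflect (mild ν U₀ F t) = mild ν (conjReflect U₀) (fun s => conjReflect (F s)) t := by
  ext1 ξ
  have hh : ∀ r, heatSymbol ν r (-ξ) = heatSymbol ν r ξ := fun r => by simp [heatSymbol]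
  simp only [conjReflect_eq, mild, map_add, hh, map_smul, intervalIntegral, map_sub]
  have hc : ∀ (μ : Measure ℝ) (φ : ℝ → C3), conjC3 (∫ s, φ s ∂μ) = ∫ s, conjC3 (φ s) ∂μ :=
    fun μ φ => (conjC3.toLinearIsometry.integral_comp_comm φ).symm
  simp only [hc, map_smul]

theorem FourierSolution.conjReflect {ν : ℝ} {U₀ : R3 → C3} {T : ℝ} {U : ℝ → R3 → C3}
    (hU : FourierSolution ν U₀ T U) (h0 : conjReflect U₀ =ᵐ[volume] U₀) :
    FourierSolution ν U₀ T fun t => conjReflect (U t) where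
  meas := by
    have : (Function.uncurry fun t => ChiNS.conjReflect (U t)) =
        fun p : ℝ × R3 => conjC3 (Function.uncurry U (p.1, -p.2)) := by
      ext1 p
      exact conjReflect_eq _ _
    rw [this]
    exact conjC3.continuous.measurable.comp
      (hU.meas.comp (measurable_fst.prodMk measurable_snd.neg))
  sq_ne_top := by simpa only [densityNorm_conjReflect] using hU.sq_ne_top
  eq_mild := by
    filter_upwards [hU.eq_mild] with t ht
    refine (conjReflect_congr ht).trans ?_
    rw [conjReflect_mild]
    have : (fun s => ChiNS.conjReflect (forcing U s)) =
        forcing fun s => ChiNS.conjReflect (U s) := by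
      ext1 s
      exact (nonlinearHat_conjReflect (U s)).symm
    rw [this]
    exact mild_congr_data ν h0 _ t

theorem MaximalSolution.conjReflect_ae_eq {ν : ℝ} {U₀ : R3 → C3} {V : ℝ → R3 → C3}
    (h : MaximalSolution ν U₀ V) (h0 : conjReflect U₀ =ᵐ[volume] U₀) {t : ℝ} (ht : 0 ≤ t)
    (htmax : ENNReal.ofReal t < fourierMaxTime ν U₀) : conjReflect (V t) =ᵐ[volume] V t := by
  rcases ht.eq_or_lt with rfl | ht
  · rwa [h.initial]
  have hae := h.ae_eq ht ((h.solution t ht htmax).conjReflect h0)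
  have hF : (fun s => conjReflect (forcing V s)) = forcing fun s => conjReflect (V s) := by
    ext1 s
    exact (nonlinearHat_conjReflect (V s)).symm
  have e : conjReflect (V t) = mild ν (conjReflect U₀) (forcing V) t := by
    conv_lhs => rw [h.eq_mild t ht.le htmax]
    rw [conjReflect_mild, hF]
    exact mild_congr ν _ (hae.mono fun s hs => nonlinearHat_congr hs) ht.le le_rfl
  rw [e]
  conv_rhs => rw [h.eq_mild t ht.le htmax]
  exact mild_congr_data ν h0 _ t

open Classical in
/-- The field with a given Fourier density (zero if there is none). -/
def toField (g : R3 → C3) : Field3 :=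
  if h : ∃ f, HasFourierDensity f g then h.choose else 0

theorem hasFourierDensity_toField {g : R3 → C3} (hm : Measurable g)
    (hg : densityNorm (-1) g ≠ ⊤) : HasFourierDensity (toField g) g := by
  have h := exists_hasFourierDensity hm.aestronglyMeasurable hg
  rw [toField, dif_pos h]
  exact h.choose_spec

theorem MemChi.exists_measurable_density {f : Field3} {s : ℤ} (hf : MemChi s f) :
    ∃ g, Measurable g ∧ HasFourierDensity f g ∧ densityNorm s g ≠ ⊤ := by
  obtain ⟨g, hg⟩ := iInf_lt_iff.1 hf
  obtain ⟨hfg, -⟩ := iInf_lt_iff.1 hg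
  have hm := hfg.locallyIntegrable.aestronglyMeasurable
  have hmk := hfg.congr hm.ae_eq_mk
  refine ⟨hm.mk g, hm.stronglyMeasurable_mk.measurable, hmk, ?_⟩
  rw [← hmk.chiNorm_eq s]
  exact hf.ne

theorem IsSolution.exists_fourierSolution {ν : ℝ} {u₀ : Field3} {T : ℝ} {v : ℝ → Field3}
    (hv : IsSolution ν u₀ T v) {U₀ : R3 → C3} (h₀ : HasFourierDensity u₀ U₀) :
    ∃ W, FourierSolution ν U₀ T W ∧
      ∀ᵐ t ∂(volume.restrict (Ioc 0 T)), HasFourierDensity (v t) (W t) := by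
  obtain ⟨U₀', U, h₀', ⟨hm, hd⟩, hU⟩ := hv.duhamel
  have hv2 := hv.memL2.2
  rw [← restrict_Ioc_eq_restrict_Icc] at hm hd hU hv2
  set W : ℝ → R3 → C3 := fun t ξ => hm.mk (Function.uncurry U) (t, ξ) with hW
  have hWm : Measurable (Function.uncurry W) := hm.stronglyMeasurable_mk.measurable
  have hUW : ∀ᵐ t ∂(volume.restrict (Ioc 0 T)), U t =ᵐ[volume] W t :=
    Measure.ae_ae_of_ae_prod hm.ae_eq_mk
  have hdW : ∀ᵐ t ∂(volume.restrict (Ioc 0 T)), HasFourierDensity (v t) (W t) := by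
    filter_upwards [hd, hUW] with t h1 h2
    exact h1.congr h2
  refine ⟨W, ⟨hWm, ?_, ?_⟩, hdW⟩
  · have h1 := (eLpNorm_lt_top_iff_lintegral_rpow_enorm_lt_top (by simp) (by simp)).1 hv2
    rw [← lintegral_congr_ae (f := fun t => chiNorm 0 (v t) ^ 2)
      (hdW.mono fun t ht => by simp only [ht.chiNorm_eq])]
    simpa using h1.ne
  · have hF : ∀ᵐ s ∂(volume.restrict (Ioc 0 T)), forcing U s = forcing W s :=
      hUW.mono fun s hs => nonlinearHat_congr hs
    filter_upwards [hUW, hU, ae_restrict_mem measurableSet_Ioc] with t h1 h2 h3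
    rw [← mild_congr ν U₀ hF h3.1.le h3.2]
    refine h1.symm.trans (EventuallyEq.trans ?_ (mild_congr_data ν (h₀'.ae_eq h₀) _ t))
    exact h2

namespace MaximalSolution

variable {ν : ℝ} {U₀ : R3 → C3} {V : ℝ → R3 → C3}

theorem hasFourierDensity (h : MaximalSolution ν U₀ V) {t : ℝ} (ht : 0 ≤ t)
    (htmax : ENNReal.ofReal t < fourierMaxTime ν U₀) :
    HasFourierDensity (toField (V t)) (V t) :=
  hasFourierDensity_toField h.meas.of_uncurry_left (h.densityNorm_ne_top ht htmax)

theorem hasSpaceTimeDensity (h : MaximalSolution ν U₀ V) {T : ℝ}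
    (hTmax : ENNReal.ofReal T < fourierMaxTime ν U₀) :
    HasSpaceTimeDensity (Icc 0 T) (fun t => toField (V t)) V :=
  ⟨h.meas.aestronglyMeasurable, (ae_restrict_mem measurableSet_Icc).mono fun _ ht =>
    h.hasFourierDensity ht.1 (h.lt_of_le ht.2 hTmax)⟩

theorem eLpNorm_chiNorm (h : MaximalSolution ν U₀ V) {T : ℝ}
    (hTmax : ENNReal.ofReal T < fourierMaxTime ν U₀) (p : ℝ≥0∞) (s : ℤ) :
    eLpNorm (fun t => chiNorm s (toField (V t))) p (volume.restrict (Icc 0 T)) =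
      eLpNorm (fun t => densityNorm s (V t)) p (volume.restrict (Icc 0 T)) :=
  eLpNorm_congr_ae ((ae_restrict_mem measurableSet_Icc).mono fun _ ht =>
    (h.hasFourierDensity ht.1 (h.lt_of_le ht.2 hTmax)).chiNorm_eq s)

theorem isSolution (h : MaximalSolution ν U₀ V) {u₀ : Field3} (h₀ : HasFourierDensity u₀ U₀)
    (hdiv : IsDivFree u₀) {T : ℝ} (hT : 0 < T)
    (hTmax : ENNReal.ofReal T < fourierMaxTime ν U₀) :
    IsSolution ν u₀ T fun t => toField (V t) where
  memL2 := by
    refine ⟨⟨V, h.hasSpaceTimeDensity hTmax⟩, ?_⟩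
    rw [h.eLpNorm_chiNorm hTmax,
      eLpNorm_lt_top_iff_lintegral_rpow_enorm_lt_top (by simp) (by simp),
      ← restrict_Ioc_eq_restrict_Icc]
    simpa using lt_top_iff_ne_top.2 (h.solution T hT hTmax).sq_ne_top
  divFree := by
    filter_upwards [ae_restrict_mem measurableSet_Icc] with t ht
    have htm := h.lt_of_le ht.2 hTmax
    exact (h.hasFourierDensity ht.1 htm).isDivFree_iff.2
      (h.sum_mul (h₀.isDivFree_iff.1 hdiv) ht.1 htm)
  duhamel := by
    refine ⟨U₀, V, h₀, h.hasSpaceTimeDensity hTmax, ?_⟩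
    filter_upwards [ae_restrict_mem measurableSet_Icc] with t ht
    refine .of_forall fun ξ => ?_
    exact congrFun (h.eq_mild t ht.1 (h.lt_of_le ht.2 hTmax)) ξ

theorem isRegular (h : MaximalSolution ν U₀ V) {T : ℝ} (hT : 0 < T)
    (hTmax : ENNReal.ofReal T < fourierMaxTime ν U₀) :
    IsRegular T fun t => toField (V t) where
  cont := by
    intro t ht
    have htm := h.lt_of_le ht.2 hTmax
    have hd := h.hasFourierDensity ht.1 htm
    refine ⟨?_, (h.tendsto_sub hTmax ht).congr' ?_⟩
    · rw [MemChi, hd.chiNorm_eq]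
      exact lt_top_iff_ne_top.2 (h.densityNorm_ne_top ht.1 htm)
    · filter_upwards [self_mem_nhdsWithin] with τ hτ
      exact (((h.hasFourierDensity hτ.1 (h.lt_of_le hτ.2 hTmax)).sub hd).chiNorm_eq (-1)).symm
  memL1 := by
    refine ⟨⟨V, h.hasSpaceTimeDensity hTmax⟩, ?_⟩
    rw [h.eLpNorm_chiNorm hTmax, eLpNorm_one_eq_lintegral_enorm, ← restrict_Ioc_eq_restrict_Icc]
    simpa using lt_top_iff_ne_top.2 (h.lintegral_densityNorm_one_ne_top hT.le hTmax)
  memLinfty := by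
    refine ⟨⟨V, h.hasSpaceTimeDensity hTmax⟩, ?_⟩
    rw [h.eLpNorm_chiNorm hTmax, eLpNorm_exponent_top, eLpNormEssSup]
    refine (essSup_le_of_ae_le _ ?_).trans_lt (lt_top_iff_ne_top.2 (ENNReal.add_ne_top.2
      ⟨h.data_ne_top, h.lintegral_forcing_ne_top hT.le hTmax⟩))
    filter_upwards [ae_restrict_mem measurableSet_Icc] with t ht
    rw [enorm_eq_self]
    exact h.densityNorm_le ht.1 ht.2 hTmax

theorem maxTime_eq (h : MaximalSolution ν U₀ V) {u₀ : Field3} (h₀ : HasFourierDensity u₀ U₀)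
    (hdiv : IsDivFree u₀) : maxTime ν u₀ = fourierMaxTime ν U₀ := by
  have : ∀ T : ℝ, (0 < T ∧ ∃ u, IsSolution ν u₀ T u) ↔
      (0 < T ∧ ∃ U, FourierSolution ν U₀ T U) := by
    intro T
    refine and_congr_right fun hT => ⟨?_, ?_⟩
    · rintro ⟨u, hu⟩
      obtain ⟨W, hW, -⟩ := hu.exists_fourierSolution h₀
      exact ⟨W, hW⟩
    · rintro ⟨U, hU⟩
      exact ⟨_, h.isSolution h₀ hdiv hT
        (hU.lt_fourierMaxTime h.pos h.meas_data h.data_ne_top hT.le)⟩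
  simp only [maxTime, fourierMaxTime, this]

theorem ae_eq_toField (h : MaximalSolution ν U₀ V) {u₀ : Field3} (h₀ : HasFourierDensity u₀ U₀)
    {T : ℝ} (hT : 0 < T) {v : ℝ → Field3} (hv : IsSolution ν u₀ T v) :
    ∀ᵐ t ∂(volume.restrict (Icc 0 T)), v t = toField (V t) := by
  obtain ⟨W, hW, hvW⟩ := hv.exists_fourierSolution h₀
  have hTmax := hW.lt_fourierMaxTime h.pos h.meas_data h.data_ne_top hT.le
  rw [← restrict_Ioc_eq_restrict_Icc]
  filter_upwards [hvW, h.ae_eq hT hW, ae_restrict_mem measurableSet_Ioc] with t h1 h2 h3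
  exact (h1.congr h2).unique (h.hasFourierDensity h3.1.le (h.lt_of_le h3.2 hTmax))

end MaximalSolution

end ChiNS

end

open ChiNS
theorem theorem1p2 (ν : ℝ) (hν : 0 < ν) (u₀ : ChiNS.Field3)
    (hu₀ : ChiNS.MemChi (-1) u₀) (hdiv : ChiNS.IsDivFree u₀) :
    -- local well-posedness
    (∃ T : ℝ, 0 < T ∧ ∃ u : ℝ → ChiNS.Field3,
      ChiNS.IsSolution ν u₀ T u ∧ ChiNS.IsRegular T u ∧ u 0 = u₀ ∧
      ∀ v, ChiNS.IsSolution ν u₀ T v → ∀ᵐ t ∂(volume.restrict (Icc 0 T)), v t = u t) ∧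
    -- the maximal solution
    ∃ u : ℝ → ChiNS.Field3,
      u 0 = u₀ ∧
      (∀ T : ℝ, 0 < T → ENNReal.ofReal T < ChiNS.maxTime ν u₀ →
        ChiNS.IsSolution ν u₀ T u ∧ ChiNS.IsRegular T u) ∧
      -- every solution on any interval coincides with it
      (∀ T : ℝ, 0 < T → ∀ v, ChiNS.IsSolution ν u₀ T v →
        ∀ᵐ t ∂(volume.restrict (Icc 0 T)), v t = u t) ∧
      -- real data give a real solution
      (ChiNS.IsRealField u₀ →
        ∀ t : ℝ, 0 ≤ t → ENNReal.ofReal t < ChiNS.maxTime ν u₀ → ChiNS.IsRealField (u t)) ∧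
      -- (i) global existence, with the a priori estimate
      (ChiNS.chiNorm (-1) u₀ < ENNReal.ofReal ν →
        ChiNS.maxTime ν u₀ = ⊤ ∧
        ∀ t : ℝ, 0 ≤ t →
          ChiNS.chiNorm (-1) (u t) +
            (ENNReal.ofReal ν - ChiNS.chiNorm (-1) u₀) *
              ∫⁻ s in Icc 0 t, ChiNS.chiNorm 1 (u s) ≤ ChiNS.chiNorm (-1) u₀) ∧
      -- (ii) blow-up criterion
      (ChiNS.maxTime ν u₀ ≠ ⊤ →
        ∫⁻ t in Ico 0 (ChiNS.maxTime ν u₀).toReal, ChiNS.chiNorm 0 (u t) ^ 2 = ⊤) := by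

  obtain ⟨U₀, hU₀m, hU₀, hU₀f⟩ := hu₀.exists_measurable_density
  obtain ⟨V, hV⟩ := exists_maximalSolution hν hU₀m hU₀f
  have hmax : maxTime ν u₀ = fourierMaxTime ν U₀ := hV.maxTime_eq hU₀ hdiv
  have hpos : 0 < fourierMaxTime ν U₀ := fourierMaxTime_pos hν hU₀m hU₀f
  have hinit : toField (V 0) = u₀ := by
    have := hV.hasFourierDensity le_rfl (by simpa using hpos)
    rw [hV.initial] at this ⊢
    exact this.unique hU₀
  have hnorm : ∀ t, 0 ≤ t → ENNReal.ofReal t < fourierMaxTime ν U₀ → ∀ s,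
      chiNorm s (toField (V t)) = densityNorm s (V t) := fun t ht h s =>
    (hV.hasFourierDensity ht h).chiNorm_eq s
  rw [hmax]
  refine ⟨?_, fun t => toField (V t), hinit, ?_, ?_, ?_, ?_, ?_⟩
  · obtain ⟨r, hr0, hr⟩ := ENNReal.lt_iff_exists_nnreal_btwn.1 hpos
    have hr0' : (0 : ℝ) < r := by simpa using hr0
    have hr' : ENNReal.ofReal r < fourierMaxTime ν U₀ := by simpa using hr
    exact ⟨r, hr0', fun t => toField (V t), hV.isSolution hU₀ hdiv hr0' hr',
      hV.isRegular hr0' hr', hinit, fun v hv => hV.ae_eq_toField hU₀ hr0' hv⟩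
  · exact fun T hT hTmax => ⟨hV.isSolution hU₀ hdiv hT hTmax, hV.isRegular hT hTmax⟩
  · exact fun T hT v hv => hV.ae_eq_toField hU₀ hT hv
  · intro hreal t ht htmax
    exact (hV.hasFourierDensity ht htmax).isRealField_iff.2
      (hV.conjReflect_ae_eq (hU₀.isRealField_iff.1 hreal) ht htmax)
  · intro hsmall
    rw [hU₀.chiNorm_eq] at hsmall ⊢
    have htop := hV.small_data_global hsmall
    have hlt : ∀ t : ℝ, ENNReal.ofReal t < fourierMaxTime ν U₀ := fun t => by
      rw [htop]; exact ENNReal.ofReal_lt_top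
    refine ⟨htop, fun t ht => ?_⟩
    rw [hnorm t ht (hlt t), setLIntegral_congr_fun (g := fun s => densityNorm 1 (V s))
      measurableSet_Icc fun s hs => hnorm s hs.1 (hlt s) 1, ← restrict_Ioc_eq_restrict_Icc]
    exact hV.small_data_energy hsmall ht (hlt t)
  · intro hne
    have hT0 : 0 < (fourierMaxTime ν U₀).toReal := ENNReal.toReal_pos hpos.ne' hne
    rw [setLIntegral_congr_fun (g := fun s => densityNorm 0 (V s) ^ 2) measurableSet_Ico
      fun t ht => by
        have htm : ENNReal.ofReal t < fourierMaxTime ν U₀ := by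
          rw [← ENNReal.ofReal_toReal hne]
          exact (ENNReal.ofReal_lt_ofReal_iff hT0).2 ht.2
        simp only [hnorm t ht.1 htm],
      Measure.restrict_congr_set Ico_ae_eq_Ioc]
    exact hV.blowup hne
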